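/- **Setting.** Let $\Omega\subset\mathbb R^d$ be open and bounded and let $\mathcal X$ be a Hilbert space of real functions on $\Omega$ (up to a.e. equality) such that, for some $r\in\mathbb N_0$, the restrictions to $\Omega$ of the functions in $C^r(\mathbb R^d)$ lie in $\mathcal X$, are dense in $\mathcal X$, and satisfy $\|f\|_{\mathcal X}\le K\max_{j\le r}\sup_\Omega|D^jf|$. Let $\mathcal V,\mathcal W$ be Hilbert spaces, $\mathcal L:\mathcal X\to\mathcal V$, $\mathcal B:\mathcal X\to\mathcal W$ bounded and linear with $\|v\|_{\mathcal X}\le C(\|\mathcal Lv\|_{\mathcal V}+\|\mathcal Bv\|_{\mathcal W})$ for all $v\in\mathcal X$, and let $\delta\ge1$. Put $a(v,w)=(\mathcal Lv,\mathcal Lw)_{\mathcal V}+\delta(\mathcal Bv,\mathcal Bw)_{\mathcal W}$, $|||v|||=a(v,v)^{1/2}$ and, for data $f\in\mathcal V$, $g\in\mathcal W$, $F(v)=(f,\mathcal Lv)_{\mathcal V}+\delta(g,\mathcal Bv)_{\mathcal W}$ and $\langle r(w),v\rangle=F(v)-a(w,v)$. Let $u\in\mathcal X$ solve $a(u,v)=F(v)$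 for all $v\in\mathcal X$, and let $u=u_\infty+u_\Psi$ with $u_\infty\in\mathcal X$ and $u_\Psi=\sum_{j=1}^{\mathcal M}d_j\Psi(\cdot;\lambda_j)$, where $\Psi(\cdot;\lambda_j)\in\mathcal X$. **Networks.** Let $\sigma\in C^r(\mathbb R)$ not be a polynomial. For $\mathbf n\in\mathbb N^L$, $V_{\mathbf n,L}^{\sigma,C}\subset\mathcal X$ is the set of functions $x\mapsto(\sigma\circ T_L\circ\dots\circ\sigma\circ T_1)(x)\cdot\mathbf c$, $T_j(t)=t\mathbf W^{(j)}+\mathbf b^{(j)}$, with layer widths $\mathbf n$ and $\sum_j(\|\mathbf W^{(j)}\|_\infty+\|\mathbf b^{(j)}\|_\infty)+\|\mathbf c\|_\infty\le C$. For $\Phi:\Omega\times\mathbb R\to\mathbb R$ and $m\in\mathbb N_0$, $V_m^{\Phi}$ is the set of all $\sum_{j=1}^m d_j\Phi(\cdot;\mu_j)$ with $\mathbf d,\mu\in\mathbb R^m$ and $\Phi(\cdot;\mu_j)\in\mathcal X$; $V_m^{\Phi}(\mu)$ is its subset for fixed $\mu$; $V_m^{\Phi,C}$ and $V_m^{\Phi,C}(\mu)$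 are their parts with $\|\mathbf d\|_\infty+\|\mu\|_\infty\le C$. Below, $\oplus$ is the sum of sets. **Iteration.** Let $u_0=u_{\sigma,0}+u_{\Psi,0}$ with $u_{\sigma,0}\in\mathcal X$ and $u_{\Psi,0}\in V_{m_*}^{\Phi}(\mu^{(0)})$. For $i\ge1$ and given $\mathbf n^{(i)}\in\mathbb N^{L_i}$ and bounds $C_1,C_2$ (which may depend on $i$), put $$\mathcal S_i=V_{\mathbf n^{(i)},L_i}^{\sigma,C_1}\oplus\Big(V_{m_*}^{\Phi,C_2}\oplus V_{m_*}^{\Phi,C_2}(\mu^{(i-1)})\oplus\dots\oplus V_{m_*}^{\Phi,C_2}(\mu^{(0)})\Big),$$ $$\varphi_i^{NN}\in\operatorname*{arg\,max}_{v\in\mathcal S_i,\ |||v|||=1}\langle r(u_{i-1}),v\rangle .\tag{1}$$ Write $\varphi_i^{NN}=\varphi_{\sigma,i}^{NN}+\varphi_{\Psi,i}^{NN}$ for its network part and its knowledge-based part, and let $\mu^{(i)}$ be the parameters of the component of $\varphi_{\Psi,i}^{NN}$ in $V_{m_*}^{\Phi,C_2}$. Then $u_i$ is a Galerkin solution, $a(u_i,v)=F(v)$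 for all $v\in\mathrm{span}\{u_{\sigma,0},u_{\Psi,0},\varphi_{\sigma,j}^{NN},\varphi_{\Psi,j}^{NN}:1\le j\le i\}$, written as $u_i=u_{\sigma,i}+u_{\Psi,i}$ with $u_{\sigma,i}\in\mathrm{span}\{u_{\sigma,0},\varphi_{\sigma,1}^{NN},\dots,\varphi_{\sigma,i}^{NN}\}$ and $u_{\Psi,i}\in\mathrm{span}\{u_{\Psi,0},\varphi_{\Psi,1}^{NN},\dots,\varphi_{\Psi,i}^{NN}\}$. **Proposition.** Let $i\ge1$, $L_i\ge1$, $\varepsilon>0$, let $i-1$ iterations have been carried out, let $u\ne u_{i-1}$, and put $N=|||u-u_{i-1}|||$ and $\varphi_i=(u-u_{i-1})/N$. Suppose that $m_*$ is so large that there is $\tilde\varphi_\Phi\in V_{m_*}^{\Phi}$ with $$|||u_\Psi-\tilde\varphi_\Phi|||\le\tfrac{\varepsilon}{2}\,N .$$ Then there are $\mathbf n^{(i)}\in\mathbb N^{L_i}$ and $C_1>0$ that depend only on $\varepsilon$ and the relative error $(u_\infty-u_{\sigma,i-1})/N$ of the smooth part, and $C_2>0$ that depends only on $\varepsilon$ and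 the relative error $(u_\Psi-u_{\Psi,i-1})/N$ of the singular part, such that the set $\{v\in\mathcal S_i:|||v|||=1\}$ is nonempty and every $\varphi_i^{NN}$ as in (1) satisfies $$|||\varphi_i-\varphi_i^{NN}|||\le2\varepsilon ;$$ such a $\varphi_i^{NN}$ exists if $V_{m_*}^{\Phi,C_2}$ is compact in $\mathcal X$. Here $\mathcal X,\mathcal L,\mathcal B,\delta,\sigma,L_i$ are fixed; $\mathbf n^{(i)}$ and $C_1$ do not depend on $\Phi$, $m_*$, $i$ or $\mu^{(0)},\dots,\mu^{(i-1)}$, while $C_2$, like the space that it bounds, may depend on them. -/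

import Mathlib

open MeasureTheory
open scoped Pointwise

noncomputable section

namespace XGNN

/-! ### Hilbert spaces of functions on a domain -/

/-- `X` is a Hilbert space of (classes of a.e. equal) real functions on `Ω ⊆ ℝ^d`, of smoothness
order `r`: restrictions to `Ω` of `C^r` functions belong to `X`, the `X`-norm is controlled by the
`C^r(Ω)`-norm on them, and they are dense. Examples: `L²(Ω)` with `r = 0`, the Sobolev spaces
`H^r(Ω)` and their weighted variants with bounded weights, on bounded Lipschitz domains. -/
structure HilbertFunctionSpace (d : ℕ) (Ω : Set (Fin d → ℝ)) (r : ℕ) (X : Type*)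
    [NormedAddCommGroup X] [InnerProductSpace ℝ X] where
  /-- the function (up to a.e. equality on `Ω`) that an element of `X` is -/
  toFun : X →ₗ[ℝ] ((Fin d → ℝ) →ₘ[volume.restrict Ω] ℝ)
  toFun_injective : Function.Injective toFun
  exists_of_contDiff : ∀ f : (Fin d → ℝ) → ℝ, ContDiff ℝ r f →
    ∃ v : X, toFun v =ᵐ[volume.restrict Ω] f
  norm_le_of_contDiff : ∃ K : ℝ, ∀ (f : (Fin d → ℝ) → ℝ) (v : X), ContDiff ℝ r f →
    toFun v =ᵐ[volume.restrict Ω] f → ∀ B : ℝ, 0 ≤ B →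
      (∀ j ≤ r, ∀ x ∈ Ω, ‖iteratedFDeriv ℝ j f x‖ ≤ B) → ‖v‖ ≤ K * B
  dense_contDiff : Dense {v : X | ∃ f : (Fin d → ℝ) → ℝ,
    ContDiff ℝ r f ∧ toFun v =ᵐ[volume.restrict Ω] f}

/-- The element `v` of `X` is the function `f` on `Ω`. -/
def HilbertFunctionSpace.Represents {d : ℕ} {Ω : Set (Fin d → ℝ)} {r : ℕ} {X : Type*}
    [NormedAddCommGroup X] [InnerProductSpace ℝ X] (H : HilbertFunctionSpace d Ω r X)
    (v : X) (f : (Fin d → ℝ) → ℝ) : Prop :=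
  H.toFun v =ᵐ[volume.restrict Ω] f

/-! ### Feedforward networks -/

/-- Parameters of a feedforward network with input dimension `d` and hidden widths `ns` (so the
depth `L` is `ns.length`): for each hidden layer a weight matrix `W` (rows indexed by the inputs,
columns by the outputs) and a bias vector `b`, and finally the output coefficients `c`. -/
def NetParams : ℕ → List ℕ → Type
  | d, [] => Fin d → ℝ
  | d, n :: ns => (Fin d → Fin n → ℝ) × (Fin n → ℝ) × NetParams n ns

/-- The realization `x ↦ (σ ∘ T_L ∘ ⋯ ∘ σ ∘ T_1)(x) · c` with `T_j t = t · W_j + b_j`. -/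
def realize (σ : ℝ → ℝ) : (d : ℕ) → (ns : List ℕ) → NetParams d ns → (Fin d → ℝ) → ℝ
  | d, [], c, x => ∑ l : Fin d, x l * (c : Fin d → ℝ) l
  | d, n :: ns, (W, b, p), x => realize σ n ns p (fun j => σ ((∑ l : Fin d, x l * W l j) + b j))

/-- `∑_j (‖W_j‖_∞ + ‖b_j‖_∞) + ‖c‖_∞`, with the largest absolute value of an entry as `‖·‖_∞`. -/
def paramNorm : (d : ℕ) → (ns : List ℕ) → NetParams d ns → ℝ
  | d, [], c => norm (E := Fin d → ℝ) c
  | _, n :: ns, (W, b, p) => ‖W‖ + ‖b‖ + paramNorm n ns p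

section Sets

variable {d : ℕ} {Ω : Set (Fin d → ℝ)} {r : ℕ} {X : Type*}
  [NormedAddCommGroup X] [InnerProductSpace ℝ X] (H : HilbertFunctionSpace d Ω r X)

/-- `V_{n,L}^{σ,C}`: the elements of `X` realized by a network with widths `ns` and parameters
bounded by `C`. -/
def networkSet (σ : ℝ → ℝ) (ns : List ℕ) (C : ℝ) : Set X :=
  {v | ∃ p : NetParams d ns, paramNorm d ns p ≤ C ∧ H.Represents v (realize σ d ns p)}

/-! ### Knowledge-based functions -/

/-- `I_Φ = {μ : Φ(·; μ) ∈ X}`. -/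
def admissible (Φ : (Fin d → ℝ) → ℝ → ℝ) : Set ℝ :=
  {μ | ∃ v : X, H.Represents v (fun x => Φ x μ)}

/-- `V_m^Φ`: the functions `∑_j d_j Φ(·; μ_j)`, with arbitrary `d_j` and `μ_j ∈ I_Φ`. -/
def knowledgeSet (Φ : (Fin d → ℝ) → ℝ → ℝ) (m : ℕ) : Set X :=
  {v | ∃ c μ : Fin m → ℝ, (∀ j, μ j ∈ admissible H Φ) ∧
    H.Represents v (fun x => ∑ j, c j * Φ x (μ j))}

/-- `V_m^{Φ,C}`: the part of `V_m^Φ` with `‖d‖_∞ + ‖μ‖_∞ ≤ C`. -/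
def knowledgeSetBdd (Φ : (Fin d → ℝ) → ℝ → ℝ) (m : ℕ) (C : ℝ) : Set X :=
  {v | ∃ c μ : Fin m → ℝ, (∀ j, μ j ∈ admissible H Φ) ∧ ‖c‖ + ‖μ‖ ≤ C ∧
    H.Represents v (fun x => ∑ j, c j * Φ x (μ j))}

/-- `V_m^Φ(μ)`: the functions `∑_j d_j Φ(·; μ_j)` for fixed `μ`. -/
def knowledgeSetFixed (Φ : (Fin d → ℝ) → ℝ → ℝ) {m : ℕ} (μ : Fin m → ℝ) : Set X :=
  {v | ∃ c : Fin m → ℝ, H.Represents v (fun x => ∑ j, c j * Φ x (μ j))}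

/-- `V_m^{Φ,C}(μ)`: the part of `V_m^Φ(μ)` with `‖d‖_∞ + ‖μ‖_∞ ≤ C`. -/
def knowledgeSetFixedBdd (Φ : (Fin d → ℝ) → ℝ → ℝ) {m : ℕ} (μ : Fin m → ℝ) (C : ℝ) : Set X :=
  {v | ∃ c : Fin m → ℝ, ‖c‖ + ‖μ‖ ≤ C ∧ H.Represents v (fun x => ∑ j, c j * Φ x (μ j))}

/-- `V_{n,L}^{σ,C₁} ⊕ (V_m^{Φ,C₂} ⊕ V_m^{Φ,C₂}(μ^{(i-1)}) ⊕ ⋯ ⊕ V_m^{Φ,C₂}(μ^{(0)}))`,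
with sums of sets. -/
def searchSet (σ : ℝ → ℝ) (ns : List ℕ) (C₁ : ℝ) (Φ : (Fin d → ℝ) → ℝ → ℝ) (m : ℕ) (C₂ : ℝ)
    (μ : ℕ → Fin m → ℝ) (i : ℕ) : Set X :=
  networkSet H σ ns C₁ +
    (knowledgeSetBdd H Φ m C₂ + ∑ l ∈ Finset.range i, knowledgeSetFixedBdd H Φ (μ l) C₂)

end Sets

/-! ### Least squares formulation -/

section LeastSquares

variable {X V W : Type*} [NormedAddCommGroup X] [InnerProductSpace ℝ X]
  [NormedAddCommGroup V] [InnerProductSpace ℝ V] [NormedAddCommGroup W] [InnerProductSpace ℝ W]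
  (𝓛 : X →L[ℝ] V) (𝓑 : X →L[ℝ] W) (δ : ℝ)

/-- `a_LS(u, v) = (𝓛u, 𝓛v) + δ (𝓑u, 𝓑v)`. -/
def aLS (u v : X) : ℝ := inner ℝ (𝓛 u) (𝓛 v) + δ * inner ℝ (𝓑 u) (𝓑 v)

/-- `F_LS(v) = (f, 𝓛v) + δ (g, 𝓑v)`. -/
def FLS (f : V) (g : W) (v : X) : ℝ := inner ℝ f (𝓛 v) + δ * inner ℝ g (𝓑 v)

/-- The energy norm `|||v||| = a_LS(v, v)^{1/2}`. -/
def energyNorm (v : X) : ℝ := Real.sqrt (aLS 𝓛 𝓑 δ v v)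

/-- The weak residual `⟨r(w), v⟩ = F_LS(v) - a_LS(w, v)`. -/
def residual (f : V) (g : W) (w v : X) : ℝ := FLS 𝓛 𝓑 δ f g v - aLS 𝓛 𝓑 δ w v

/-- `φ` maximizes the weak residual `⟨r(w), ·⟩` over the elements of `S` with energy norm `1`. -/
def IsResidualArgmax (f : V) (g : W) (w : X) (S : Set X) (φ : X) : Prop :=
  φ ∈ S ∧ energyNorm 𝓛 𝓑 δ φ = 1 ∧
    ∀ v ∈ S, energyNorm 𝓛 𝓑 δ v = 1 → residual 𝓛 𝓑 δ f g w v ≤ residual 𝓛 𝓑 δ f g w φ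

variable {d : ℕ} {Ω : Set (Fin d → ℝ)} {r : ℕ} (H : HilbertFunctionSpace d Ω r X)

/-- The outcome of `k` iterations of the extended Galerkin neural network method with trainable
nonlinear parameters, with data `f`, `g`, where `μ j` are the nonlinear parameters of iteration
`j` (and `μ 0` those of the initial approximation). Only the entries with index at most `k` of the
sequences matter. The approximations are `u_j = uσ j + uΨ j`, the basis functions
`φσ j + φΨ j`, `1 ≤ j ≤ k`. -/
structure Run (f : V) (g : W) (σ : ℝ → ℝ) (Φ : (Fin d → ℝ) → ℝ → ℝ) (m k : ℕ)
    (μ : ℕ → Fin m → ℝ) where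
  /-- smooth and singular parts of the approximations -/
  uσ : ℕ → X
  uΨ : ℕ → X
  /-- network part and knowledge-based part of the basis functions -/
  φσ : ℕ → X
  φΨ : ℕ → X
  /-- network widths and parameter bounds used in each iteration -/
  widths : ℕ → List ℕ
  C₁ : ℕ → ℝ
  C₂ : ℕ → ℝ
  μ_mem : ∀ j ≤ k, ∀ l, μ j l ∈ admissible H Φ
  /-- the initial approximation `uσ 0 + uΨ 0` is arbitrary, up to the form of `uΨ 0` -/
  initial : uΨ 0 ∈ knowledgeSetFixed H Φ (μ 0)
  φσ_mem : ∀ j < k, φσ (j + 1) ∈ networkSet H σ (widths (j + 1)) (C₁ (j + 1))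
  φΨ_mem : ∀ j < k, φΨ (j + 1) ∈ knowledgeSetFixedBdd H Φ (μ (j + 1)) (C₂ (j + 1)) +
    ∑ l ∈ Finset.range (j + 1), knowledgeSetFixedBdd H Φ (μ l) (C₂ (j + 1))
  argmax : ∀ j < k, IsResidualArgmax 𝓛 𝓑 δ f g (uσ j + uΨ j)
    (searchSet H σ (widths (j + 1)) (C₁ (j + 1)) Φ m (C₂ (j + 1)) μ (j + 1))
    (φσ (j + 1) + φΨ (j + 1))
  uσ_mem : ∀ j < k, uσ (j + 1) ∈
    Submodule.span ℝ ({uσ 0} ∪ {w | ∃ l ≤ j, w = φσ (l + 1)})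
  uΨ_mem : ∀ j < k, uΨ (j + 1) ∈
    Submodule.span ℝ ({uΨ 0} ∪ {w | ∃ l ≤ j, w = φΨ (l + 1)})
  /-- `u_{j+1}` is the Galerkin approximation in the span of `uσ 0`, `uΨ 0` and of both parts of
  the first `j + 1` basis functions -/
  galerkin : ∀ j < k, ∀ v ∈ Submodule.span ℝ ({uσ 0, uΨ 0} ∪
      {w | ∃ l ≤ j, w = φσ (l + 1) ∨ w = φΨ (l + 1)}),
    aLS 𝓛 𝓑 δ (uσ (j + 1) + uΨ (j + 1)) v = FLS 𝓛 𝓑 δ f g v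

end LeastSquares

end XGNN

end

noncomputable section

namespace XGNN

open Set Filter Topology

/-! ### Jets of `C^r` functions on a compact set -/

theorem integral_mem_of_isClosed {P Y : Type*} [MeasurableSpace P] {ν : Measure P}
    {S : Set P} [NormedAddCommGroup Y] [NormedSpace ℝ Y]
    [CompleteSpace Y]
    {M : Submodule ℝ Y} (hM : IsClosed (M : Set Y)) {F : P → Y}
    (hF : IntegrableOn F S ν) (h : ∀ᵐ p ∂(ν.restrict S), F p ∈ M) : ∫ p in S, F p ∂ν ∈ M := by
  by_contra hn
  obtain ⟨l, hl0, hl⟩ : ∃ l : Y →L[ℝ] ℝ, (∀ y ∈ M, l y = 0) ∧ l (∫ p in S, F p ∂ν) ≠ 0 := by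
    obtain ⟨l, u, h1, h2⟩ := geometric_hahn_banach_closed_point M.convex hM hn
    have h0 : ∀ y ∈ M, l y = 0 := by
      intro y hy
      by_contra hy0
      -- A functional bounded above on a subspace vanishes there: this multiple of y would attain
      -- the excluded value u.
      have := h1 ((u / l y) • y) (M.smul_mem _ hy)
      simp [hy0] at this
    refine ⟨l, h0, fun h3 => ?_⟩
    have := h1 0 M.zero_mem
    simp only [map_zero] at this
    linarith
  apply hl
  rw [← l.integral_comp_comm hF]
  exact integral_eq_zero_of_ae (h.mono fun p hp => hl0 _ hp)

section Jets

variable {E : Type*} [NormedAddCommGroup E] [NormedSpace ℝ E]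

/-- Families of continuous functions on `K` with the types of the derivatives of order at most `r`
of a real function. -/
def JetSpace (r : ℕ) (K : Set E) : Type _ :=
  (j : Fin (r + 1)) → C(K, ContinuousMultilinearMap ℝ (fun _ : Fin (j : ℕ) => E) ℝ)

instance (r : ℕ) (K : Set E) [CompactSpace K] : NormedAddCommGroup (JetSpace r K) :=
  inferInstanceAs (NormedAddCommGroup ((j : Fin (r + 1)) →
    C(K, ContinuousMultilinearMap ℝ (fun _ : Fin (j : ℕ) => E) ℝ)))

instance (r : ℕ) (K : Set E) [CompactSpace K] : NormedSpace ℝ (JetSpace r K) :=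
  inferInstanceAs (NormedSpace ℝ ((j : Fin (r + 1)) →
    C(K, ContinuousMultilinearMap ℝ (fun _ : Fin (j : ℕ) => E) ℝ)))

instance (r : ℕ) (K : Set E) [CompactSpace K] : CompleteSpace (JetSpace r K) :=
  inferInstanceAs (CompleteSpace ((j : Fin (r + 1)) →
    C(K, ContinuousMultilinearMap ℝ (fun _ : Fin (j : ℕ) => E) ℝ)))

/-- Evaluation of one of the derivatives at a point. -/
def jetEval (r : ℕ) (K : Set E) [CompactSpace K] (j : Fin (r + 1)) (x : K) :
    JetSpace r K →L[ℝ] ContinuousMultilinearMap ℝ (fun _ : Fin (j : ℕ) => E) ℝ :=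
  (ContinuousMap.evalCLM ℝ x).comp (ContinuousLinearMap.proj (R := ℝ)
    (φ := fun j : Fin (r + 1) =>
      C(K, ContinuousMultilinearMap ℝ (fun _ : Fin (j : ℕ) => E) ℝ)) j)

/-- The derivatives of order at most `r` of a `C^r` function, restricted to `K`. -/
def jet (r : ℕ) (K : Set E) (f : E → ℝ) (hf : ContDiff ℝ r f) : JetSpace r K := fun j =>
  ⟨fun x => iteratedFDeriv ℝ j f x,
    (hf.continuous_iteratedFDeriv (by exact_mod_cast Nat.lt_succ_iff.1 j.2)).comp
      continuous_subtype_val⟩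

theorem jet_congr {r : ℕ} {K : Set E} {f g : E → ℝ} (hf : ContDiff ℝ r f) (hg : ContDiff ℝ r g)
    (h : ∀ x ∈ K, f =ᶠ[𝓝 x] g) : jet r K f hf = jet r K g hg := by
  funext j
  ext1 x
  exact ((h x x.2).iteratedFDeriv ℝ (j : ℕ)).eq_of_nhds

/-- `f` is a `C^r` function whose jet belongs to `M`. -/
def JetMem {r : ℕ} {K : Set E} [CompactSpace K] (M : Submodule ℝ (JetSpace r K)) (f : E → ℝ) :
    Prop :=
  ∃ hf : ContDiff ℝ r f, jet r K f hf ∈ M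

variable {r : ℕ} {K : Set E} [CompactSpace K]

theorem order_le {r : ℕ} (j : Fin (r + 1)) : ((j : ℕ) : WithTop ℕ∞) ≤ (r : WithTop ℕ∞) := by
  exact_mod_cast Nat.lt_succ_iff.1 j.2

theorem jet_add {f g : E → ℝ} (hf : ContDiff ℝ r f) (hg : ContDiff ℝ r g) :
    jet r K (f + g) (hf.add hg) = jet r K f hf + jet r K g hg := by
  funext j
  ext1 x
  exact iteratedFDeriv_add_apply ((hf.of_le (order_le j)).contDiffAt)
    ((hg.of_le (order_le j)).contDiffAt)

theorem jet_smul {f : E → ℝ} (c : ℝ) (hf : ContDiff ℝ r f) :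
    jet r K (c • f) (contDiff_const.smul hf) = c • jet r K f hf := by
  funext j
  ext1 x
  exact iteratedFDeriv_const_smul_apply ((hf.of_le (order_le j)).contDiffAt)

/-- `C^r` functions depending on a parameter `p`, with derivatives jointly continuous. -/
structure JetFamily {P : Type*} [TopologicalSpace P] (r : ℕ) (G : P → E → ℝ) : Prop where
  contDiff : ∀ p, ContDiff ℝ r (G p)
  continuous : ∀ j : ℕ, j ≤ r → Continuous fun q : P × E => iteratedFDeriv ℝ j (G q.1) q.2

theorem JetFamily.continuous_jet {P : Type*} [TopologicalSpace P] {G : P → E → ℝ}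
    (hG : JetFamily r G) : Continuous fun p => jet r K (G p) (hG.contDiff p) := by
  refine continuous_pi (A := fun j : Fin (r + 1) =>
    C(K, ContinuousMultilinearMap ℝ (fun _ : Fin (j : ℕ) => E) ℝ)) fun j => ?_
  refine ContinuousMap.continuous_of_continuous_uncurry _ ?_
  exact (hG.continuous j (Nat.lt_succ_iff.1 j.2)).comp
    (continuous_fst.prodMk (continuous_subtype_val.comp continuous_snd))

theorem JetFamily.smul {P : Type*} [TopologicalSpace P] {G : P → E → ℝ}
    (hG : JetFamily r G) {c : P → ℝ} (hc : Continuous c) : JetFamily r (fun p => c p • G p) := by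
  refine ⟨fun p => contDiff_const.smul (hG.contDiff p), fun j hj => ?_⟩
  have h : (fun q : P × E => iteratedFDeriv ℝ j (c q.1 • G q.1) q.2) =
      fun q => c q.1 • iteratedFDeriv ℝ j (G q.1) q.2 := by
    funext q
    exact iteratedFDeriv_const_smul_apply
      (((hG.contDiff q.1).of_le (by exact_mod_cast hj)).contDiffAt)
  rw [h]
  exact (hc.comp continuous_fst).smul (hG.continuous j hj)

theorem JetFamily.of_contDiff {P : Type*} [NormedAddCommGroup P] [NormedSpace ℝ P]
    {G : P → E → ℝ} (hG : ContDiff ℝ r (fun q : P × E => G q.1 q.2)) : JetFamily r G := by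
  refine ⟨fun p => hG.comp (contDiff_const.prodMk contDiff_id), fun j hj => ?_⟩
  have hj' : (j : WithTop ℕ∞) ≤ (r : WithTop ℕ∞) := by exact_mod_cast hj
  set F : P × E → ℝ := fun q => G q.1 q.2
  have h : (fun q : P × E => iteratedFDeriv ℝ j (G q.1) q.2) =
      fun q => (iteratedFDeriv ℝ j F q).compContinuousLinearMap (fun _ => ContinuousLinearMap.inr ℝ P E) := by
    funext q
    -- Freezing the parameter is a translation followed by the inclusion of E, so the partial
    -- derivatives are the joint ones precomposed with that inclusion.
    have h1 : G q.1 = (fun z : P × E => F ((q.1, 0) + z)) ∘ ContinuousLinearMap.inr ℝ P E := by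
      funext x
      simp [F]
    conv_lhs => rw [h1]
    rw [ContinuousLinearMap.iteratedFDeriv_comp_right (n := r)
      (f := fun z : P × E => F ((q.1, 0) + z)) _
      (hG.comp (contDiff_const.add contDiff_id)) _ hj', iteratedFDeriv_comp_add_left]
    simp
  rw [h]
  exact (ContinuousMultilinearMap.compContinuousLinearMapL
    (fun _ : Fin j => ContinuousLinearMap.inr ℝ P E)).continuous.comp
      (hG.continuous_iteratedFDeriv hj')

/-! ### Differentiation under the integral sign -/

section Integral

variable [FiniteDimensional ℝ E] {P : Type*} [TopologicalSpace P] [TopologicalSpace.MetrizableSpace P]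
  [SecondCountableTopology P] [MeasurableSpace P] [BorelSpace P] {ν : Measure P} [IsLocallyFiniteMeasure ν]
  {S : Set P} {G : P → E → ℝ}

theorem JetFamily.hasFTaylorSeriesUpTo_integral (hG : JetFamily r G) (hS : IsCompact S) :
    HasFTaylorSeriesUpTo r (fun x => ∫ p in S, G p x ∂ν)
      (fun x j => ∫ p in S, iteratedFDeriv ℝ j (G p) x ∂ν) := by
  have hint : ∀ j ≤ r, ∀ x, IntegrableOn (fun p => iteratedFDeriv ℝ j (G p) x) S ν := by
    intro j hj x
    exact ((hG.continuous j hj).comp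
      (continuous_id.prodMk continuous_const)).continuousOn.integrableOn_compact hS
  have hderiv : ∀ m : ℕ, m < r → ∀ x,
      HasFDerivAt (fun x => ∫ p in S, iteratedFDeriv ℝ m (G p) x ∂ν)
        (∫ p in S, (iteratedFDeriv ℝ (m + 1) (G p) x).curryLeft ∂ν) x := by
    intro m hm x
    have hcont : Continuous fun q : P × E => iteratedFDeriv ℝ (m + 1) (G q.1) q.2 :=
      hG.continuous _ hm
    -- Joint continuity on a compact product gives a constant dominating function for all points
    -- near x.
    obtain ⟨B, hB⟩ := ((hS.prod (isCompact_closedBall x 1)).image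
      hcont.norm).bddAbove
    refine hasFDerivAt_integral_of_dominated_of_fderiv_le (s := Metric.closedBall x 1)
      (F' := fun x p => (iteratedFDeriv ℝ (m + 1) (G p) x).curryLeft) (bound := fun _ => B)
      (Metric.closedBall_mem_nhds x one_pos) ?_ (hint m hm.le x) ?_ ?_ ?_ ?_
    · exact Eventually.of_forall fun y => (hint m hm.le y).aestronglyMeasurable
    · have hc : Continuous fun p => (iteratedFDeriv ℝ (m + 1) (G p) x).curryLeft :=
        (continuousMultilinearCurryLeftEquiv ℝ (fun _ : Fin (m + 1) => E) ℝ).continuous.comp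
          (hcont.comp (continuous_id.prodMk continuous_const))
      exact (hc.continuousOn.integrableOn_compact hS).aestronglyMeasurable
    · refine (ae_restrict_iff' hS.measurableSet).2 (Eventually.of_forall fun p hp y hy => ?_)
      rw [ContinuousMultilinearMap.curryLeft_norm]
      exact hB ⟨(p, y), ⟨hp, hy⟩, rfl⟩
    · exact integrableOn_const hS.measure_lt_top.ne
    · refine Eventually.of_forall fun p y _ => ?_
      exact (hG.contDiff p).ftaylorSeries.fderiv m (by exact_mod_cast hm) y
  have hcurry : ∀ m : ℕ, m < r → ∀ x,
      ∫ p in S, (iteratedFDeriv ℝ (m + 1) (G p) x).curryLeft ∂ν =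
        (∫ p in S, iteratedFDeriv ℝ (m + 1) (G p) x ∂ν).curryLeft := by
    intro m hm x
    let l : ContinuousMultilinearMap ℝ (fun _ : Fin (m + 1) => E) ℝ →L[ℝ]
        E →L[ℝ] ContinuousMultilinearMap ℝ (fun _ : Fin m => E) ℝ :=
      (continuousMultilinearCurryLeftEquiv ℝ (fun _ : Fin (m + 1) => E)
        ℝ).toContinuousLinearEquiv.toContinuousLinearMap
    exact ContinuousLinearMap.integral_comp_comm (𝕜 := ℝ)
      (Fₗ := E →L[ℝ] ContinuousMultilinearMap ℝ (fun _ : Fin m => E) ℝ) l (hint (m + 1) hm x)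
  refine ⟨fun x => ?_, fun m hm x => ?_, fun m hm => ?_⟩
  · have h := (continuousMultilinearCurryFin0 ℝ E
      ℝ).toContinuousLinearEquiv.toContinuousLinearMap.integral_comp_comm (hint 0 r.zero_le x)
    exact h.symm
  · have hm' : m < r := by exact_mod_cast hm
    have h := hderiv m hm' x
    rw [hcurry m hm' x] at h
    exact h
  · have hm' : m ≤ r := by exact_mod_cast hm
    exact continuous_parametric_integral_of_continuous (μ := ν) (s := S)
      (f := fun x p => iteratedFDeriv ℝ m (G p) x)
      ((hG.continuous m hm').comp continuous_swap) hS

theorem JetFamily.contDiff_integral (hG : JetFamily r G) (hS : IsCompact S) :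
    ContDiff ℝ r fun x => ∫ p in S, G p x ∂ν :=
  (hG.hasFTaylorSeriesUpTo_integral hS).contDiff

theorem JetFamily.jet_integral (hG : JetFamily r G) (hS : IsCompact S) :
    jet r K (fun x => ∫ p in S, G p x ∂ν) (hG.contDiff_integral hS) =
      ∫ p in S, jet r K (G p) (hG.contDiff p) ∂ν := by
  have hint : IntegrableOn (fun p => jet r K (G p) (hG.contDiff p)) S ν :=
    hG.continuous_jet.continuousOn.integrableOn_compact hS
  funext j
  ext1 x
  have h1 := (jetEval r K j x).integral_comp_comm hint
  refine Eq.trans ?_ h1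
  exact ((hG.hasFTaylorSeriesUpTo_integral hS).eq_iteratedFDeriv (order_le j) (x : E)).symm

variable {M : Submodule ℝ (JetSpace r K)}

theorem JetMem.integral (hM : IsClosed (M : Set (JetSpace r K))) (hG : JetFamily r G)
    (hS : IsCompact S) (h : ∀ p ∈ S, JetMem M (G p)) : JetMem M (fun x => ∫ p in S, G p x ∂ν) := by
  refine ⟨hG.contDiff_integral hS, ?_⟩
  rw [hG.jet_integral hS]
  refine integral_mem_of_isClosed hM (hG.continuous_jet.continuousOn.integrableOn_compact hS) ?_
  refine (ae_restrict_iff' hS.measurableSet).2 (Eventually.of_forall fun p hp => ?_)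
  exact (h p hp).2

end Integral

variable {M : Submodule ℝ (JetSpace r K)}

theorem JetMem.add {f g : E → ℝ} (hf : JetMem M f) (hg : JetMem M g) : JetMem M (f + g) := by
  refine ⟨hf.1.add hg.1, ?_⟩
  rw [jet_add hf.1 hg.1]
  exact M.add_mem hf.2 hg.2

theorem JetMem.smul {f : E → ℝ} (c : ℝ) (hf : JetMem M f) : JetMem M (c • f) := by
  refine ⟨contDiff_const.smul hf.1, ?_⟩
  rw [jet_smul c hf.1]
  exact M.smul_mem c hf.2

theorem JetMem.zero : JetMem M (0 : E → ℝ) := by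
  have h0 : ContDiff ℝ r (0 : E → ℝ) := contDiff_const
  refine ⟨h0, ?_⟩
  have h : jet r K (0 : E → ℝ) h0 = 0 := by
    have h1 := jet_add (K := K) h0 h0
    have h2 : jet r K (0 + 0 : E → ℝ) (h0.add h0) = jet r K 0 h0 := by
      congr 1
      simp
    rw [h2] at h1
    exact left_eq_add.1 h1
  rw [h]
  exact M.zero_mem

theorem JetMem.congr {f g : E → ℝ} (hf : JetMem M f) (hg : ContDiff ℝ r g)
    (h : ∀ x ∈ K, f =ᶠ[𝓝 x] g) : JetMem M g :=
  ⟨hg, jet_congr (K := K) hf.1 hg h ▸ hf.2⟩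

/-- Partial derivatives with respect to a parameter stay in a closed space of jets. -/
theorem JetMem.deriv_param [FiniteDimensional ℝ E] (hM : IsClosed (M : Set (JetSpace r K)))
    {G D : ℝ → E → ℝ} (hD : JetFamily r D)
    (hder : ∀ s x, HasDerivAt (fun s => G s x) (D s x) s) (h : ∀ s, JetMem M (G s)) (s : ℝ) :
    JetMem M (D s) := by
  refine ⟨hD.contDiff s, ?_⟩
  have hc : Continuous fun t => jet r K (D t) (hD.contDiff t) := hD.continuous_jet
  -- The averages of the jets of D over [s, t] are the jets of the difference quotients of G, hence
  -- lie in M; they converge to the jet at s.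
  have hlim : Tendsto (fun t => (t - s)⁻¹ • ∫ τ in s..t, jet r K (D τ) (hD.contDiff τ))
      (𝓝[>] s) (𝓝 (jet r K (D s) (hD.contDiff s))) := by
    have h1 := intervalIntegral.integral_hasDerivAt_right (a := s) (b := s)
      (hc.intervalIntegrable _ _) (hc.stronglyMeasurableAtFilter _ _) hc.continuousAt
    have h2 := h1.hasDerivWithinAt (s := Ioi s)
    rw [hasDerivWithinAt_iff_tendsto_slope' (by simp)] at h2
    refine h2.congr fun t => ?_
    simp [slope_def_module]
  refine hM.mem_of_tendsto hlim ?_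
  filter_upwards [self_mem_nhdsWithin] with t ht
  refine M.smul_mem _ ?_
  have hst : s ≤ t := le_of_lt ht
  rw [intervalIntegral.integral_of_le hst, ← integral_Icc_eq_integral_Ioc,
    ← hD.jet_integral isCompact_Icc]
  have heq : (fun x => ∫ τ in Icc s t, D τ x) = G t + (-1 : ℝ) • G s := by
    funext x
    have hDx : Continuous fun τ => D τ x := by
      have h0 := (hD.continuous 0 r.zero_le).comp (continuous_id.prodMk
        (continuous_const (y := x)))
      have h3 := (continuousMultilinearCurryFin0 ℝ E ℝ).continuous.comp h0
      exact h3
    rw [integral_Icc_eq_integral_Ioc, ← intervalIntegral.integral_of_le hst,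
      intervalIntegral.integral_eq_sub_of_hasDerivAt (fun τ _ => hder τ x)
        (hDx.intervalIntegrable _ _)]
    simp [sub_eq_add_neg]
  obtain ⟨h4, h5⟩ := (h t).add ((h s).smul (-1))
  convert h5 using 2

/-- Jets within `η` of each other: the derivatives are uniformly close. -/
theorem norm_jet_sub_lt {f g : E → ℝ} (hf : ContDiff ℝ r f) (hg : ContDiff ℝ r g) {η : ℝ}
    (h : ‖jet r K f hf - jet r K g hg‖ < η) (j : ℕ) (hj : j ≤ r) (x : E) (hx : x ∈ K) :
    ‖iteratedFDeriv ℝ j (fun y => f y - g y) x‖ ≤ η := by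
  have h1 := (norm_le_pi_norm (jet r K f hf - jet r K g hg) ⟨j, Nat.lt_succ_of_le hj⟩).trans h.le
  have h2 := (ContinuousMap.norm_coe_le_norm _ (⟨x, hx⟩ : K)).trans h1
  have hj' : (j : WithTop ℕ∞) ≤ (r : WithTop ℕ∞) := by exact_mod_cast hj
  have h3 : iteratedFDeriv ℝ j (fun y => f y - g y) x =
      iteratedFDeriv ℝ j f x - iteratedFDeriv ℝ j g x :=
    iteratedFDeriv_sub_apply ((hf.of_le hj').contDiffAt) ((hg.of_le hj').contDiffAt)
  rw [h3]
  exact h2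

end Jets

/-! ### Non-polynomial activation functions -/

/-- Induction on k: the derivative of one order less is constant, and subtracting the matching
monomial makes it vanish. -/
theorem exists_polynomial_of_iteratedDeriv_eq_zero (k : ℕ) {g : ℝ → ℝ} (hg : ContDiff ℝ (⊤ : ℕ∞) g)
    (h : ∀ x, iteratedDeriv k g x = 0) :
    ∃ p : Polynomial ℝ, p.degree < k ∧ ∀ x, g x = p.eval x := by
  induction k generalizing g with
  | zero => exact ⟨0, by simp, fun x => by simpa using h x⟩
  | succ k ih =>
    have hd : Differentiable ℝ (iteratedDeriv k g) :=
      hg.differentiable_iteratedDeriv k (by exact_mod_cast ENat.natCast_lt_top k)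
    have hc : ∀ x, iteratedDeriv k g x = iteratedDeriv k g 0 := fun x =>
      is_const_of_deriv_eq_zero hd (fun y => by rw [← iteratedDeriv_succ]; exact h y) x 0
    set c := iteratedDeriv k g 0 / (k.factorial : ℝ) with hcdef
    have hpow : ContDiff ℝ (⊤ : ℕ∞) fun x : ℝ => c * x ^ k := by fun_prop
    obtain ⟨p, hp, hpe⟩ := ih (hg.sub hpow) (fun x => by
      have hk : (k.factorial : ℝ) ≠ 0 := by positivity
      have hkt : (k : WithTop ℕ∞) ≤ ((⊤ : ℕ∞) : WithTop ℕ∞) := by exact_mod_cast le_top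
      have h1 : iteratedDeriv k (fun x => g x - c * x ^ k) x =
          iteratedDeriv k g x - iteratedDeriv k (fun x => c * x ^ k) x :=
        iteratedDeriv_sub (hg.of_le hkt).contDiffAt (hpow.of_le hkt).contDiffAt
      rw [h1, hc x, iteratedDeriv_const_mul_field, iteratedDeriv_pow, Nat.descFactorial_self,
        hcdef, Nat.sub_self, pow_zero]
      field_simp
      ring)
    refine ⟨p + Polynomial.C c * Polynomial.X ^ k, ?_, fun x => ?_⟩
    · refine (Polynomial.degree_add_le _ _).trans_lt (max_lt ?_ ?_)
      · exact hp.trans (by exact_mod_cast Nat.lt_succ_self k)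
      · exact (Polynomial.degree_C_mul_X_pow_le k c).trans_lt (by exact_mod_cast Nat.lt_succ_self k)
    · have := hpe x
      simp at this ⊢
      linarith

/-- Polynomials of degree below k are determined linearly by their values at the k nodes 0, …, k-1,
so convergence at the nodes identifies the limit everywhere. -/
theorem exists_polynomial_of_tendsto (k : ℕ) {σ : ℝ → ℝ} {p : ℕ → Polynomial ℝ}
    (hp : ∀ n, (p n).degree < k) (h : ∀ x, Tendsto (fun n => (p n).eval x) atTop (𝓝 (σ x))) :
    ∃ q : Polynomial ℝ, ∀ x, σ x = q.eval x := by
  set v : ℕ → ℝ := fun i => i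
  refine ⟨Lagrange.interpolate (Finset.range k) v (fun i => σ (v i)), fun x => ?_⟩
  refine tendsto_nhds_unique (h x) ?_
  have h1 : ∀ n, (p n).eval x = ∑ i ∈ Finset.range k,
      (p n).eval (v i) * (Lagrange.basis (Finset.range k) v i).eval x := by
    intro n
    have h2 := Lagrange.eq_interpolate_of_eval_eq (s := Finset.range k) (v := v) (f := p n)
      (fun i => (p n).eval (v i)) (fun a _ b _ hab => by simpa [v] using hab)
      (by simpa using hp n) (fun i _ => rfl)
    conv_lhs => rw [h2]
    simp [Lagrange.interpolate_apply, Polynomial.eval_finsetSum]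
  simp only [h1, Lagrange.interpolate_apply, Polynomial.eval_finsetSum, Polynomial.eval_mul,
    Polynomial.eval_C]
  exact tendsto_finsetSum _ fun i _ => (h (v i)).mul_const _

/-- Otherwise every mollification of σ would be a polynomial of degree below k, and so would their
pointwise limit σ. The uniform degree bound is essential. -/
theorem exists_convolution_iteratedDeriv_ne_zero {σ : ℝ → ℝ} (hσ : Continuous σ)
    (hσp : ¬ ∃ p : Polynomial ℝ, ∀ t, σ t = p.eval t) (k : ℕ) :
    ∃ φ g : ℝ → ℝ, Continuous φ ∧ HasCompactSupport φ ∧ ContDiff ℝ (⊤ : ℕ∞) g ∧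
      (∀ x, g x = ∫ t, φ t * σ (x - t)) ∧ ∃ b, iteratedDeriv k g b ≠ 0 := by
  by_contra! hno
  apply hσp
  let φ : ℕ → ContDiffBump (0 : ℝ) := fun n =>
    ⟨1 / (2 * ((n : ℝ) + 1)), 1 / ((n : ℝ) + 1), by positivity, by
      apply one_div_lt_one_div_of_lt <;> linarith [n.cast_nonneg (α := ℝ)]⟩
  let g : ℕ → ℝ → ℝ := fun n =>
    MeasureTheory.convolution ((φ n).normed volume) σ (ContinuousLinearMap.lsmul ℝ ℝ) volume
  have hgs : ∀ n, ContDiff ℝ (⊤ : ℕ∞) (g n) := fun n =>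
    (φ n).hasCompactSupport_normed.contDiff_convolution_left _ (φ n).contDiff_normed
      hσ.locallyIntegrable
  have hpol : ∀ n, ∃ p : Polynomial ℝ, p.degree < k ∧ ∀ x, g n x = p.eval x := fun n =>
    exists_polynomial_of_iteratedDeriv_eq_zero k (hgs n)
      (hno ((φ n).normed volume) (g n) (φ n).continuous_normed (φ n).hasCompactSupport_normed (hgs n)
        (fun x => by simp [g, MeasureTheory.convolution]))
  choose p hp hpe using hpol
  refine exists_polynomial_of_tendsto k hp fun x => ?_
  simp only [← hpe]
  refine ContDiffBump.convolution_tendsto_right_of_continuous ?_ hσ x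
  exact tendsto_one_div_add_atTop_nhds_zero_nat

/-! ### Closed spaces of jets that contain all neurons -/

section Neurons

variable {d r : ℕ} {K : Set (Fin d → ℝ)} [CompactSpace K] {M : Submodule ℝ (JetSpace r K)}

theorem jetMem_convolution_neuron (hM : IsClosed (M : Set (JetSpace r K))) {σ : ℝ → ℝ}
    (hσ : ContDiff ℝ r σ)
    (h : ∀ (w : Fin d → ℝ) (b : ℝ), JetMem M fun x => σ ((∑ l, x l * w l) + b))
    {φ g : ℝ → ℝ} (hφ : Continuous φ) (hφc : HasCompactSupport φ)
    (hg : ∀ x, g x = ∫ t, φ t * σ (x - t)) (w : Fin d → ℝ) (b : ℝ) :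
    JetMem M fun x => g ((∑ l, x l * w l) + b) := by
  have hfam : JetFamily r (fun (t : ℝ) (x : Fin d → ℝ) => σ ((∑ l, x l * w l) + b - t)) := by
    refine JetFamily.of_contDiff (hσ.comp ?_)
    fun_prop
  have h1 := JetMem.integral (ν := volume) hM (hfam.smul hφ) hφc.isCompact (fun t _ => by
    refine JetMem.smul _ ?_
    simpa [add_sub_assoc] using h w (b - t))
  convert h1 using 2 with x
  rw [hg]
  refine (setIntegral_eq_integral_of_forall_compl_eq_zero fun t ht => ?_).symm
  simp [image_eq_zero_of_notMem_tsupport ht]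

/-- Each derivative in the weight w_i produces a factor x_i and raises the order of the derivative
of g by one. -/
theorem jetMem_list_prod_mul_iteratedDeriv (hM : IsClosed (M : Set (JetSpace r K))) {g : ℝ → ℝ}
    (hg : ContDiff ℝ (⊤ : ℕ∞) g)
    (h : ∀ (w : Fin d → ℝ) (b : ℝ), JetMem M fun x => g ((∑ l, x l * w l) + b))
    (s : List (Fin d)) (w : Fin d → ℝ) (b : ℝ) :
    JetMem M fun x => (s.map x).prod * iteratedDeriv s.length g ((∑ l, x l * w l) + b) := by
  induction s generalizing w b with
  | nil => simpa using h w b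
  | cons i s ih =>
    have hsm : ∀ n, ContDiff ℝ (⊤ : ℕ∞) (iteratedDeriv n g) := fun n => by
      rw [iteratedDeriv_eq_iterate]
      exact hg.iterate_deriv n
    have hprod : ∀ s : List (Fin d), ContDiff ℝ r fun x : Fin d → ℝ => (s.map x).prod := by
      intro s
      induction s with
      | nil => simpa using contDiff_const
      | cons j s ih =>
        simp only [List.map_cons, List.prod_cons]
        exact (contDiff_apply _ _ j).mul ih
    have hD : JetFamily r (fun (t : ℝ) (x : Fin d → ℝ) =>
        ((i :: s).map x).prod * iteratedDeriv (s.length + 1) g ((∑ l, x l * w l) + b + t * x i)) := by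
      refine JetFamily.of_contDiff (((hprod _).comp contDiff_snd).mul
        (((hsm _).of_le (by exact_mod_cast le_top)).comp ?_))
      fun_prop
    have h1 := JetMem.deriv_param hM (G := fun (t : ℝ) (x : Fin d → ℝ) =>
        (s.map x).prod * iteratedDeriv s.length g ((∑ l, x l * w l) + b + t * x i)) hD
      (fun t x => ?_) (fun t => ?_) 0
    · simpa using h1
    · have h2 : HasDerivAt (iteratedDeriv s.length g)
          (iteratedDeriv (s.length + 1) g ((∑ l, x l * w l) + b + t * x i))
          ((∑ l, x l * w l) + b + t * x i) := by
        rw [iteratedDeriv_succ]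
        exact ((hsm _).differentiable (by simp) _).hasDerivAt
      have h3 : HasDerivAt (fun t => (∑ l, x l * w l) + b + t * x i) (x i) t := by
        simpa using ((hasDerivAt_id t).mul_const (x i)).const_add ((∑ l, x l * w l) + b)
      refine ((h2.comp t h3).const_mul (s.map x).prod).congr_deriv ?_
      simp only [List.map_cons, List.prod_cons]
      ring
    · have h4 := ih (w + t • Pi.single i 1) b
      convert h4 using 4 with x
      have : ∑ l, x l * (w + t • Pi.single i (1 : ℝ) : Fin d → ℝ) l = (∑ l, x l * w l) + t * x i := by
        simp [mul_add, Finset.sum_add_distrib, Pi.single_apply, mul_comm]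
      rw [this]
      ring

theorem jetMem_polynomial (hM : IsClosed (M : Set (JetSpace r K))) {σ : ℝ → ℝ}
    (hσ : ContDiff ℝ r σ) (hσp : ¬ ∃ p : Polynomial ℝ, ∀ t, σ t = p.eval t)
    (h : ∀ (w : Fin d → ℝ) (b : ℝ), JetMem M fun x => σ ((∑ l, x l * w l) + b))
    (p : MvPolynomial (Fin d) ℝ) : JetMem M fun x => MvPolynomial.eval x p := by
  have hlist : ∀ s : List (Fin d), JetMem M fun x => (s.map x).prod := by
    intro s
    obtain ⟨φ, g, hφ, hφc, hg, hgφ, b, hb⟩ :=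
      exists_convolution_iteratedDeriv_ne_zero hσ.continuous hσp s.length
    -- At weight 0 the derivative of g is the nonzero constant found above; dividing by it leaves
    -- the bare monomial.
    have h1 := (jetMem_list_prod_mul_iteratedDeriv hM hg
      (jetMem_convolution_neuron hM hσ h hφ hφc hgφ) s 0 b).smul
        (iteratedDeriv s.length g b)⁻¹
    convert h1 using 2 with x
    simp only [Pi.zero_apply, mul_zero, Finset.sum_const_zero, zero_add, smul_eq_mul, Pi.smul_apply]
    field_simp
  -- `JetMem` is not known to be stable under products, so a monomial prefix is carried along to
  -- absorb the variable in the `mul_X` step.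
  suffices hs : ∀ s : List (Fin d), JetMem M fun x => (s.map x).prod * MvPolynomial.eval x p by
    simpa using hs []
  induction p using MvPolynomial.induction_on with
  | C a =>
    intro s
    convert (hlist s).smul a using 2 with x
    simp [mul_comm]
  | add p q hp hq =>
    intro s
    convert (hp s).add (hq s) using 2 with x
    simp [mul_add]
  | mul_X p i hp =>
    intro s
    convert hp (i :: s) using 2 with x
    simp
    ring

end Neurons

/-! ### Density of polynomials in `C^r` -/

section Density

variable {d r : ℕ} {R : ℝ} {M : Submodule ℝ (JetSpace r (Metric.closedBall (0 : Fin d → ℝ) R))}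

/-- A Weierstrass argument for jets: powers of a concave quadratic, normalized, concentrate at 0,
and convolving f with them gives integrals of polynomials. -/
theorem jetMem_of_polynomials (hR : 0 < R)
    (hM : IsClosed (M : Set (JetSpace r (Metric.closedBall (0 : Fin d → ℝ) R))))
    (hpoly : ∀ p : MvPolynomial (Fin d) ℝ, JetMem M fun x => MvPolynomial.eval x p)
    {f : (Fin d → ℝ) → ℝ} (hf : ContDiff ℝ r f) : JetMem M f := by
  -- A cutoff equal to 1 on a neighbourhood of the ball of radius R does not change the jet there.
  wlog hfc : ∀ x, 2 * R ≤ ‖x‖ → f x = 0 generalizing f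
  · let χ : ContDiffBump (0 : Fin d → ℝ) := ⟨3 / 2 * R, 2 * R, by positivity, by linarith⟩
    have hχf : ContDiff ℝ r (fun x => χ x * f x) := (χ.contDiff).mul hf
    have h0 : JetMem M (fun x => χ x * f x) := this hχf fun x hx => by
      rw [χ.zero_of_le_dist (by simpa using hx), zero_mul]
    · refine JetMem.congr (K := Metric.closedBall 0 R) h0 hf fun x hx => ?_
      have hx' : x ∈ Metric.ball (0 : Fin d → ℝ) (3 / 2 * R) :=
        Metric.closedBall_subset_ball (by linarith) hx
      filter_upwards [Metric.isOpen_ball.mem_nhds hx'] with y hy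
      rw [χ.one_of_mem_closedBall (Metric.ball_subset_closedBall hy), one_mul]
  refine ⟨hf, ?_⟩
  set S : Set (Fin d → ℝ) := Metric.closedBall 0 (4 * R) with hS
  have hSc : IsCompact S := isCompact_closedBall _ _
  have hfam : JetFamily r (fun (y x : Fin d → ℝ) => f (x - y)) :=
    JetFamily.of_contDiff (hf.comp (contDiff_snd.sub contDiff_fst))
  -- This makes the kernel nonnegative on the ball of radius 4R; the 1 keeps ρ positive when d = 0.
  set ρ : ℝ := d * (4 * R) ^ 2 + 1 with hρ
  have hρ0 : 0 < ρ := by positivity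
  let c : (Fin d → ℝ) → ℝ := fun y => 1 - (∑ i, y i ^ 2) / ρ
  have hc : Continuous c := by fun_prop
  have hlim := tendsto_setIntegral_pow_smul_of_unique_maximum_of_isCompact_of_continuousOn
    (μ := volume) (s := S) (x₀ := 0) (c := c)
    (g := fun y => jet r (Metric.closedBall (0 : Fin d → ℝ) R) (fun x => f (x - y))
      (hfam.contDiff y)) hSc hc.continuousOn ?_ ?_ (by simp [c]) ?_
    hfam.continuous_jet.continuousOn
  · have h0 : jet r (Metric.closedBall (0 : Fin d → ℝ) R) (fun x => f (x - 0))
        (hfam.contDiff 0) = jet r _ f hf := by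
      congr 1
      simp
    rw [h0] at hlim
    refine hM.mem_of_tendsto hlim (Eventually.of_forall fun n => M.smul_mem _ ?_)
    have hfam1 : JetFamily r (fun (y x : Fin d → ℝ) => (c y ^ n • fun x => f (x - y)) x) :=
      hfam.smul (hc.pow n)
    have hfam2 : JetFamily r (fun (z x : Fin d → ℝ) => (f z • fun x => c (x - z) ^ n) x) := by
      refine JetFamily.smul (G := fun (z x : Fin d → ℝ) => c (x - z) ^ n)
        (JetFamily.of_contDiff ?_) hf.continuous
      simp only [c]
      fun_prop
    -- Substituting z = x - y moves x into the kernel, which is polynomial in x for fixed z. For ‖x‖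
    -- < 2R the balls of radius 4R in y and 2R in z both contain all of the integrand's support.
    have h1 : JetMem M (fun x => ∫ z in Metric.closedBall (0 : Fin d → ℝ) (2 * R),
        (f z • fun x => c (x - z) ^ n) x) := by
      refine JetMem.integral hM hfam2 (isCompact_closedBall _ _) fun z _ => ?_
      refine JetMem.smul _ ?_
      convert hpoly ((1 - MvPolynomial.C ρ⁻¹ *
        ∑ i, (MvPolynomial.X i - MvPolynomial.C (z i)) ^ 2) ^ n) using 2 with x
      simp [c, div_eq_inv_mul]
    have h2 := (h1.congr (hfam1.contDiff_integral (ν := volume) hSc) fun x hx => ?_).2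
    · rw [hfam1.jet_integral hSc] at h2
      exact (setIntegral_congr_fun hSc.measurableSet fun y _ =>
        jet_smul (K := Metric.closedBall 0 R) (c y ^ n) (hfam.contDiff y)) ▸ h2
    · have hx' : x ∈ Metric.ball (0 : Fin d → ℝ) (2 * R) :=
        Metric.closedBall_subset_ball (by linarith) hx
      filter_upwards [Metric.isOpen_ball.mem_nhds hx'] with y hy
      have hy' : ‖y‖ < 2 * R := by simpa using hy
      rw [setIntegral_eq_integral_of_forall_compl_eq_zero,
        setIntegral_eq_integral_of_forall_compl_eq_zero,
        ← integral_sub_left_eq_self _ volume y]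
      · simp [mul_comm]
      · intro z hz
        have hz' : 4 * R < ‖z‖ := by simpa [hS] using hz
        have h3 : 2 * R ≤ ‖y - z‖ := by
          have := norm_sub_norm_le z y
          rw [norm_sub_rev] at this
          linarith
        simp [hfc _ h3]
      · intro z hz
        have hz' : 2 * R < ‖z‖ := by simpa using hz
        simp [hfc _ hz'.le]
  · intro y _ hy
    have : 0 < ∑ i, y i ^ 2 := by
      obtain ⟨i, hi⟩ := Function.ne_iff.1 hy
      exact Finset.sum_pos' (fun i _ => sq_nonneg _) ⟨i, Finset.mem_univ _, by
        have : y i ≠ 0 := hi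
        positivity⟩
    simp only [c, Pi.zero_apply]
    have := div_pos this hρ0
    simp
    linarith
  · intro y hy
    have hy' : ‖y‖ ≤ 4 * R := by simpa [hS] using hy
    have : ∑ i, y i ^ 2 ≤ ρ := by
      have h3 : ∀ i ∈ Finset.univ, y i ^ 2 ≤ (4 * R) ^ 2 := fun i _ => by
        have := (norm_le_pi_norm y i).trans hy'
        rw [← sq_abs]
        exact pow_le_pow_left₀ (abs_nonneg _) this 2
      have := Finset.sum_le_card_nsmul _ _ _ h3
      simp at this
      linarith
    have := div_le_one_of_le₀ this hρ0.le
    simp only [c]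
    linarith
  · apply subset_closure
    rw [mem_interior_iff_mem_nhds]
    exact Metric.closedBall_mem_nhds _ (by positivity)

end Density

/-! ### Approximation by networks in `C^r` -/

theorem contDiff_realize {r : ℕ} {σ : ℝ → ℝ} (hσ : ContDiff ℝ r σ) (ns : List ℕ) (d : ℕ)
    (p : NetParams d ns) : ContDiff ℝ r (realize σ d ns p) := by
  induction ns generalizing d with
  | nil =>
    have : ContDiff ℝ r fun x : Fin d → ℝ => ∑ l : Fin d, x l * (p : Fin d → ℝ) l := by fun_prop
    exact this
  | cons n ns ih =>
    obtain ⟨W, b, p⟩ := p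
    refine (ih n p).comp (contDiff_pi.2 fun j => hσ.comp ?_)
    fun_prop

theorem exists_realize_of_mem_span {d : ℕ} {σ : ℝ → ℝ} {f : (Fin d → ℝ) → ℝ}
    (hf : f ∈ Submodule.span ℝ (range fun (q : (Fin d → ℝ) × ℝ) (x : Fin d → ℝ) =>
      σ ((∑ l, x l * q.1 l) + q.2))) :
    ∃ n, 1 ≤ n ∧ ∃ p : NetParams d [n], f = realize σ d [n] p := by
  obtain ⟨n, c, g, rfl⟩ := Submodule.mem_span_set'.1 hf
  choose q hq using fun i => (g i).2
  -- The extra neuron has output coefficient 0; it only keeps the width positive for an empty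
  -- combination.
  let p : NetParams d [n + 1] := (fun l => Fin.cons 0 fun j => (q j).1 l,
    Fin.cons 0 fun j => (q j).2, (Fin.cons 0 c : Fin (n + 1) → ℝ))
  refine ⟨n + 1, Nat.le_add_left _ _, p, ?_⟩
  funext x
  have : realize σ d [n + 1] p x = ∑ j : Fin (n + 1), σ ((∑ l, x l *
      (Fin.cons 0 (fun j => (q j).1 l) : Fin (n + 1) → ℝ) j) +
      (Fin.cons 0 (fun j => (q j).2) : Fin (n + 1) → ℝ) j) *
      (Fin.cons 0 c : Fin (n + 1) → ℝ) j := rfl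
  rw [this, Fin.sum_univ_succ]
  simp [← hq, mul_comm]

theorem exists_shallow_network {d r : ℕ} {σ : ℝ → ℝ} (hσ : ContDiff ℝ r σ)
    (hσp : ¬ ∃ p : Polynomial ℝ, ∀ t, σ t = p.eval t) {R : ℝ} (hR : 0 < R)
    {f : (Fin d → ℝ) → ℝ} (hf : ContDiff ℝ r f) {η : ℝ} (hη : 0 < η) :
    ∃ n, 1 ≤ n ∧ ∃ p : NetParams d [n], ∀ j ≤ r, ∀ x ∈ Metric.closedBall (0 : Fin d → ℝ) R,
      ‖iteratedFDeriv ℝ j (fun y => f y - realize σ d [n] p y) x‖ ≤ η := by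
  set S := Submodule.span ℝ (range fun (q : (Fin d → ℝ) × ℝ) (x : Fin d → ℝ) =>
      σ ((∑ l, x l * q.1 l) + q.2)) with hS
  let M₀ : Submodule ℝ (JetSpace r (Metric.closedBall (0 : Fin d → ℝ) R)) :=
    { carrier := {y | ∃ g ∈ S, ∃ hg : ContDiff ℝ r g, jet r _ g hg = y}
      add_mem' := by
        rintro _ _ ⟨g, hg, hgc, rfl⟩ ⟨h, hh, hhc, rfl⟩
        exact ⟨g + h, S.add_mem hg hh, hgc.add hhc, jet_add hgc hhc⟩
      zero_mem' := ⟨0, S.zero_mem, contDiff_const, (Submodule.mem_bot ℝ).1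
        (JetMem.zero (K := Metric.closedBall (0 : Fin d → ℝ) R) (M := ⊥)).2⟩
      smul_mem' := by
        rintro c _ ⟨g, hg, hgc, rfl⟩
        exact ⟨c • g, S.smul_mem c hg, contDiff_const.smul hgc, jet_smul c hgc⟩ }
  have hclosed : IsClosed (M₀.topologicalClosure :
    Set (JetSpace r (Metric.closedBall (0 : Fin d → ℝ) R))) := M₀.isClosed_topologicalClosure
  have hneuron : ∀ (w : Fin d → ℝ) (b : ℝ),
      JetMem M₀.topologicalClosure fun x => σ ((∑ l, x l * w l) + b) := by
    intro w b
    have hc : ContDiff ℝ r fun x : Fin d → ℝ => σ ((∑ l, x l * w l) + b) := by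
      refine hσ.comp ?_
      fun_prop
    exact ⟨hc, M₀.le_topologicalClosure ⟨_, Submodule.subset_span ⟨(w, b), rfl⟩, hc, rfl⟩⟩
  have hmem := (jetMem_of_polynomials hR hclosed
    (jetMem_polynomial hclosed hσ hσp hneuron) hf).2
  obtain ⟨_, ⟨g, hg, hgc, rfl⟩, hlt⟩ := Metric.mem_closure_iff.1 hmem η hη
  obtain ⟨n, hn, p, rfl⟩ := exists_realize_of_mem_span hg
  refine ⟨n, hn, p, fun j hj x hx => ?_⟩
  rw [dist_eq_norm] at hlt
  exact norm_jet_sub_lt hf hgc hlt j hj x hx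

theorem exists_realize_append (σ : ℝ → ℝ) (n : ℕ) (q : NetParams 1 [n]) (ns : List ℕ) (d : ℕ)
    (p : NetParams d ns) : ∃ p' : NetParams d (ns ++ [n]), ∀ x,
      realize σ d (ns ++ [n]) p' x = realize σ 1 [n] q (fun _ => realize σ d ns p x) := by
  induction ns generalizing d with
  | nil =>
    obtain ⟨W, b, c⟩ := q
    -- The scalar output x · p followed by the one-row matrix W is a single layer with a rank-one
    -- matrix.
    refine ⟨(fun l j => (p : Fin d → ℝ) l * W 0 j, b, c), fun x => ?_⟩
    simp only [realize, List.nil_append, Finset.sum_mul, mul_assoc,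
      Finset.univ_unique, Finset.sum_singleton]
    rfl
  | cons m ns ih =>
    obtain ⟨W, b, p⟩ := p
    obtain ⟨p', hp'⟩ := ih m p
    exact ⟨(W, b, p'), fun x => hp' _⟩

theorem exists_network {d r : ℕ} {σ : ℝ → ℝ} (hσ : ContDiff ℝ r σ)
    (hσp : ¬ ∃ p : Polynomial ℝ, ∀ t, σ t = p.eval t) {R : ℝ} (hR : 0 < R) {L : ℕ} (hL : 1 ≤ L)
    {f : (Fin d → ℝ) → ℝ} (hf : ContDiff ℝ r f) {η : ℝ} (hη : 0 < η) :
    ∃ ns : List ℕ, ns.length = L ∧ (∀ q ∈ ns, 1 ≤ q) ∧ ∃ p : NetParams d ns,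
      ∀ j ≤ r, ∀ x ∈ Metric.closedBall (0 : Fin d → ℝ) R,
        ‖iteratedFDeriv ℝ j (fun y => f y - realize σ d ns p y) x‖ ≤ η := by
  induction L, hL using Nat.le_induction generalizing η with
  | base =>
    obtain ⟨n, hn, p, hp⟩ := exists_shallow_network hσ hσp hR hf hη
    exact ⟨[n], rfl, by simpa using hn, p, hp⟩
  | succ L _ ih =>
    obtain ⟨ns, hlen, hpos, p, hp⟩ := ih (half_pos hη)
    set N := realize σ d ns p with hN
    have hNc : ContDiff ℝ r N := contDiff_realize hσ ns d p
    let F : (Fin d → ℝ) → Fin 1 → ℝ := fun x _ => N x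
    have hF : ContDiff ℝ r F := contDiff_pi.2 fun _ => hNc
    -- D is both the radius on which the appended network must imitate the identity and, being at
    -- least 1, a base with D ≤ D^i for the chain-rule estimate, whose factor r! D^r is divided out
    -- in η'.
    obtain ⟨D, hD1, hD⟩ : ∃ D : ℝ, 1 ≤ D ∧ ∀ i ≤ r, ∀ x ∈ Metric.closedBall (0 : Fin d → ℝ) R,
        ‖iteratedFDeriv ℝ i F x‖ ≤ D := by
      have hb : ∀ i : Fin (r + 1), ∃ B : ℝ, ∀ x ∈ Metric.closedBall (0 : Fin d → ℝ) R,
          ‖iteratedFDeriv ℝ i F x‖ ≤ B := fun i =>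
        (isCompact_closedBall _ _).exists_bound_of_continuousOn
          (hF.continuous_iteratedFDeriv (order_le i)).continuousOn
      choose B hB using hb
      refine ⟨1 + ∑ i, |B i|, ?_, fun i hi x hx => ?_⟩
      · have := Finset.sum_nonneg fun (i : Fin (r + 1)) (_ : i ∈ Finset.univ) => abs_nonneg (B i)
        linarith
      · have h1 := hB ⟨i, Nat.lt_succ_of_le hi⟩ x hx
        have h2 := Finset.single_le_sum (f := fun i => |B i|) (fun i _ => abs_nonneg _)
          (Finset.mem_univ (⟨i, Nat.lt_succ_of_le hi⟩ : Fin (r + 1)))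
        have h3 := le_abs_self (B ⟨i, Nat.lt_succ_of_le hi⟩)
        simp only at h1 h2
        linarith
    have hD0 : 0 < D := by linarith
    set η' : ℝ := η / 2 / (r.factorial * D ^ r) with hη'
    have hη'0 : 0 < η' := by positivity
    have hid : ContDiff ℝ r fun t : Fin 1 → ℝ => t 0 := contDiff_apply _ _ 0
    obtain ⟨n, hn, q, hq⟩ := exists_shallow_network hσ hσp hD0 hid hη'0
    set h := realize σ 1 [n] q with hh
    have hhc : ContDiff ℝ r h := contDiff_realize hσ [n] 1 q
    obtain ⟨p', hp'⟩ := exists_realize_append σ n q ns d p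
    refine ⟨ns ++ [n], by simp [hlen], ?_, p', fun j hj x hx => ?_⟩
    · intro m hm
      rcases List.mem_append.1 hm with hm | hm
      · exact hpos m hm
      · rw [List.mem_singleton.1 hm]
        exact hn
    · have hj' : (j : WithTop ℕ∞) ≤ (r : WithTop ℕ∞) := by exact_mod_cast hj
      have hsplit : (fun y => f y - realize σ d (ns ++ [n]) p' y) =
          (fun y => f y - N y) + (fun t => t 0 - h t) ∘ F := by
        funext y
        simp [hp', F, hN, hh]
      have hF0 : F x ∈ Metric.closedBall (0 : Fin 1 → ℝ) D := by
        simpa using hD 0 r.zero_le x hx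
      have hcomp : ‖iteratedFDeriv ℝ j ((fun t => t 0 - h t) ∘ F) x‖ ≤ j.factorial * η' * D ^ j :=
        norm_iteratedFDeriv_comp_le (hid.sub hhc) hF hj' x
          (fun i hi => hq i (hi.trans hj) _ hF0)
          (fun i hi1 hi => (hD i (hi.trans hj) x hx).trans (le_self_pow₀ hD1 (by omega)))
      have hle : (j.factorial : ℝ) * η' * D ^ j ≤ η / 2 := by
        have h1 : (j.factorial : ℝ) ≤ r.factorial := by exact_mod_cast Nat.factorial_le hj
        have h2 : D ^ j ≤ D ^ r := pow_le_pow_right₀ hD1 hj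
        calc (j.factorial : ℝ) * η' * D ^ j ≤ r.factorial * η' * D ^ r := by gcongr
          _ = η / 2 := by rw [hη']; field_simp
      rw [hsplit, iteratedFDeriv_add_apply (((hf.sub hNc).of_le hj').contDiffAt)
        ((((hid.sub hhc).comp hF).of_le hj').contDiffAt)]
      refine (norm_add_le _ _).trans ?_
      linarith [hp j hj x hx]

/-! ### Networks in a Hilbert space of functions -/

section HilbertSpace

variable {d r : ℕ} {Ω : Set (Fin d → ℝ)} {X : Type*} [NormedAddCommGroup X]
  [InnerProductSpace ℝ X] (H : HilbertFunctionSpace d Ω r X)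

variable {H} in
theorem HilbertFunctionSpace.Represents.add {u v : X} {f g : (Fin d → ℝ) → ℝ}
    (hu : H.Represents u f) (hv : H.Represents v g) : H.Represents (u + v) (fun x => f x + g x) := by
  unfold HilbertFunctionSpace.Represents at *
  rw [map_add]
  filter_upwards [AEEqFun.coeFn_add (H.toFun u) (H.toFun v), hu, hv] with x h1 h2 h3
  rw [h1, Pi.add_apply, h2, h3]

variable {H} in
theorem HilbertFunctionSpace.Represents.smul {u : X} {f : (Fin d → ℝ) → ℝ} (c : ℝ)
    (hu : H.Represents u f) : H.Represents (c • u) (fun x => c * f x) := by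
  unfold HilbertFunctionSpace.Represents at *
  rw [map_smul]
  filter_upwards [AEEqFun.coeFn_smul c (H.toFun u), hu] with x h1 h2
  rw [h1, Pi.smul_apply, h2, smul_eq_mul]

variable {H} in
theorem HilbertFunctionSpace.Represents.sub {u v : X} {f g : (Fin d → ℝ) → ℝ}
    (hu : H.Represents u f) (hv : H.Represents v g) : H.Represents (u - v) (fun x => f x - g x) := by
  simpa [sub_eq_add_neg] using hu.add (hv.smul (-1))

variable {H} in
theorem HilbertFunctionSpace.Represents.unique {u v : X} {f : (Fin d → ℝ) → ℝ}
    (hu : H.Represents u f) (hv : H.Represents v f) : u = v :=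
  H.toFun_injective (AEEqFun.ext (hu.trans hv.symm))

theorem HilbertFunctionSpace.represents_zero : H.Represents 0 (fun _ => 0) := by
  unfold HilbertFunctionSpace.Represents
  rw [map_zero]
  exact AEEqFun.coeFn_zero

variable {H} in
theorem HilbertFunctionSpace.Represents.sum {ι : Type*} (s : Finset ι) {u : ι → X}
    {f : ι → (Fin d → ℝ) → ℝ} (h : ∀ i ∈ s, H.Represents (u i) (f i)) :
    H.Represents (∑ i ∈ s, u i) (fun x => ∑ i ∈ s, f i x) := by
  classical
  induction s using Finset.induction_on with
  | empty => simpa using H.represents_zero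
  | insert a s ha ih =>
    simp only [Finset.sum_insert ha]
    exact (h a (by simp)).add (ih fun i hi => h i (by simp [hi]))

theorem exists_bounded_superset (hΩb : Bornology.IsBounded Ω) :
    ∃ R : ℝ, 0 < R ∧ Ω ⊆ Metric.closedBall 0 R := by
  obtain ⟨R, hR, h⟩ := hΩb.subset_closedBall_lt 0 0
  exact ⟨R, hR, h⟩

theorem exists_network_near (hΩb : Bornology.IsBounded Ω) {σ : ℝ → ℝ} (hσ : ContDiff ℝ r σ)
    (hσp : ¬ ∃ p : Polynomial ℝ, ∀ t, σ t = p.eval t) {L : ℕ} (hL : 1 ≤ L) (e : X) {η : ℝ}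
    (hη : 0 < η) :
    ∃ ns : List ℕ, ns.length = L ∧ (∀ q ∈ ns, 1 ≤ q) ∧ ∃ (p : NetParams d ns) (v : X),
      H.Represents v (realize σ d ns p) ∧ ‖e - v‖ < η := by
  obtain ⟨R, hR, hΩR⟩ := exists_bounded_superset hΩb
  obtain ⟨K, hK⟩ := H.norm_le_of_contDiff
  obtain ⟨u, ⟨f, hf, hu⟩, hue⟩ := Metric.mem_closure_iff.1 (H.dense_contDiff e) (η / 2) (half_pos hη)
  obtain ⟨ns, hlen, hpos, p, hp⟩ := exists_network hσ hσp hR hL hf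
    (η := η / 2 / (|K| + 1)) (by positivity)
  obtain ⟨v, hv⟩ := H.exists_of_contDiff _ (contDiff_realize hσ ns d p)
  refine ⟨ns, hlen, hpos, p, v, hv, ?_⟩
  have h1 := hK _ (u - v) (hf.sub (contDiff_realize hσ ns d p))
    (HilbertFunctionSpace.Represents.sub hu hv) (η / 2 / (|K| + 1)) (by positivity)
    (fun j hj x hx => hp j hj x (hΩR hx))
  have h2 : K * (η / 2 / (|K| + 1)) ≤ η / 2 := by
    calc K * (η / 2 / (|K| + 1)) ≤ (|K| + 1) * (η / 2 / (|K| + 1)) := by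
          gcongr
          linarith [le_abs_self K]
      _ = η / 2 := by field_simp
  rw [dist_eq_norm] at hue
  calc ‖e - v‖ = ‖(e - u) + (u - v)‖ := by rw [sub_add_sub_cancel]
    _ ≤ ‖e - u‖ + ‖u - v‖ := norm_add_le _ _
    _ < η := by linarith

/-- The space of network parameters is a finite-dimensional normed space, up to a
reparametrization in which realizations are jointly `C^r`. -/
theorem exists_param_space {σ : ℝ → ℝ} (hσ : ContDiff ℝ r σ) (ns : List ℕ) (d : ℕ) :
    ∃ (P : Type) (_ : NormedAddCommGroup P) (_ : NormedSpace ℝ P) (_ : FiniteDimensional ℝ P)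
      (e : P → NetParams d ns), Function.Surjective e ∧
        Continuous (fun p => paramNorm d ns (e p)) ∧ (∀ p, ‖p‖ ≤ paramNorm d ns (e p)) ∧
        ContDiff ℝ r (fun q : P × (Fin d → ℝ) => realize σ d ns (e q.1) q.2) := by
  induction ns generalizing d with
  | nil =>
    refine ⟨Fin d → ℝ, inferInstance, inferInstance, inferInstance, fun p => p, fun p => ⟨p, rfl⟩,
      continuous_norm, fun p => le_rfl, ?_⟩
    have : ContDiff ℝ r fun q : (Fin d → ℝ) × (Fin d → ℝ) => ∑ l : Fin d, q.2 l * q.1 l := by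
      fun_prop
    exact this
  | cons n ns ih =>
    obtain ⟨P, i1, i2, i3, e, he, hc, hle, hr⟩ := ih n
    refine ⟨(Fin d → Fin n → ℝ) × (Fin n → ℝ) × P, inferInstance, inferInstance, inferInstance,
      fun q => (q.1, q.2.1, e q.2.2), ?_, ?_, ?_, ?_⟩
    · rintro ⟨W, b, p⟩
      obtain ⟨p, rfl⟩ := he p
      exact ⟨(W, b, p), rfl⟩
    · have : Continuous fun q : (Fin d → Fin n → ℝ) × (Fin n → ℝ) × P =>
          ‖q.1‖ + ‖q.2.1‖ + paramNorm n ns (e q.2.2) :=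
        (continuous_fst.norm.add (continuous_fst.comp continuous_snd).norm).add
          (hc.comp (continuous_snd.comp continuous_snd))
      exact this
    · rintro ⟨W, b, p⟩
      have h0 : 0 ≤ paramNorm n ns (e p) := (norm_nonneg p).trans (hle p)
      have h1 : paramNorm d (n :: ns) (W, b, e p) = ‖W‖ + ‖b‖ + paramNorm n ns (e p) := rfl
      have := hle p
      have := norm_nonneg W
      have := norm_nonneg b
      change ‖(W, b, p)‖ ≤ paramNorm d (n :: ns) (W, b, e p)
      rw [h1, Prod.norm_def, Prod.norm_def]
      refine max_le ?_ (max_le ?_ ?_) <;> dsimp only <;> linarith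
    · have : ContDiff ℝ r fun q : ((Fin d → Fin n → ℝ) × (Fin n → ℝ) × P) × (Fin d → ℝ) =>
          (q.1.2.2, fun j => σ ((∑ l : Fin d, q.2 l * q.1.1 l j) + q.1.2.1 j)) := by
        refine ContDiff.prodMk (by fun_prop) (contDiff_pi.2 fun j => hσ.comp ?_)
        fun_prop
      exact hr.comp this

/-- The set is the continuous image of a sublevel set of the parameter norm, which is closed and
bounded in finite dimension; continuity into X passes through the jets on a ball containing Ω. -/
theorem isCompact_networkSet (hΩb : Bornology.IsBounded Ω) {σ : ℝ → ℝ} (hσ : ContDiff ℝ r σ)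
    (ns : List ℕ) (C : ℝ) : IsCompact (networkSet H σ ns C) := by
  obtain ⟨R, hR, hΩR⟩ := exists_bounded_superset hΩb
  obtain ⟨K, hK⟩ := H.norm_le_of_contDiff
  obtain ⟨P, i1, i2, i3, e, he, hc, hle, hr⟩ := exists_param_space hσ ns d
  have hfam : JetFamily r fun (p : P) (x : Fin d → ℝ) => realize σ d ns (e p) x :=
    JetFamily.of_contDiff hr
  choose T hT using fun p => H.exists_of_contDiff _ (hfam.contDiff p)
  have hTc : Continuous T := by
    have hJ := hfam.continuous_jet (K := Metric.closedBall (0 : Fin d → ℝ) R)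
    refine continuous_iff_continuousAt.2 fun p => tendsto_iff_norm_sub_tendsto_zero.2 ?_
    have h1 := (tendsto_iff_norm_sub_tendsto_zero.1 hJ.continuousAt).const_mul K (x := 𝓝 p)
    rw [mul_zero] at h1
    refine squeeze_zero (fun _ => norm_nonneg _) (fun q => ?_) h1
    refine hK _ (T q - T p) ((hfam.contDiff q).sub (hfam.contDiff p))
      (HilbertFunctionSpace.Represents.sub (hT q) (hT p)) _ (norm_nonneg _) fun j hj x hx => ?_
    refine le_of_forall_gt_imp_ge_of_dense fun η hη => ?_
    exact norm_jet_sub_lt _ _ hη j hj x (hΩR hx)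
  have hcomp : IsCompact {p : P | paramNorm d ns (e p) ≤ C} := by
    have : ProperSpace P := FiniteDimensional.proper ℝ P
    refine (isCompact_closedBall (0 : P) C).of_isClosed_subset
      (isClosed_le hc continuous_const) fun p hp => ?_
    simpa using (hle p).trans hp
  convert hcomp.image hTc using 1
  ext v
  constructor
  · rintro ⟨p, hp, hv⟩
    obtain ⟨p, rfl⟩ := he p
    exact ⟨p, hp, HilbertFunctionSpace.Represents.unique (hT p) hv⟩
  · rintro ⟨p, hp, rfl⟩
    exact ⟨e p, hp, hT p⟩

end HilbertSpace

/-! ### The energy norm -/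

section Energy

variable {X V W : Type*} [NormedAddCommGroup X] [InnerProductSpace ℝ X]
  [NormedAddCommGroup V] [InnerProductSpace ℝ V] [NormedAddCommGroup W] [InnerProductSpace ℝ W]
  (𝓛 : X →L[ℝ] V) (𝓑 : X →L[ℝ] W) (δ : ℝ)

/-- `v ↦ (𝓛 v, √δ 𝓑 v)`, which turns the energy inner product into that of `V × W`. -/
def energyMap : X →L[ℝ] WithLp 2 (V × W) :=
  ((WithLp.prodContinuousLinearEquiv 2 ℝ V W).symm : V × W →L[ℝ] WithLp 2 (V × W)).comp
    (𝓛.prod (Real.sqrt δ • 𝓑))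

variable {δ}

theorem inner_energyMap (hδ : 0 ≤ δ) (u v : X) :
    inner ℝ (energyMap 𝓛 𝓑 δ u) (energyMap 𝓛 𝓑 δ v) = aLS 𝓛 𝓑 δ u v := by
  simp [energyMap, WithLp.prod_inner_apply, aLS, inner_smul_left, inner_smul_right, ← mul_assoc,
    Real.mul_self_sqrt hδ]

theorem norm_energyMap (hδ : 0 ≤ δ) (v : X) : ‖energyMap 𝓛 𝓑 δ v‖ = energyNorm 𝓛 𝓑 δ v := by
  rw [norm_eq_sqrt_real_inner, inner_energyMap 𝓛 𝓑 hδ, energyNorm]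

theorem energyNorm_pos (hstab : ∃ C : ℝ, 0 < C ∧ ∀ v : X, ‖v‖ ≤ C * (‖𝓛 v‖ + ‖𝓑 v‖))
    (hδ : 0 < δ) {v : X} (hv : v ≠ 0) : 0 < energyNorm 𝓛 𝓑 δ v := by
  rw [← norm_energyMap 𝓛 𝓑 hδ.le, norm_pos_iff]
  intro h0
  obtain ⟨C, _, h⟩ := hstab
  have h1 : aLS 𝓛 𝓑 δ v v = 0 := by rw [← inner_energyMap 𝓛 𝓑 hδ.le, h0, inner_zero_left]
  simp only [aLS, real_inner_self_eq_norm_sq] at h1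
  have h2 : ‖𝓛 v‖ = 0 := by
    have : ‖𝓛 v‖ ^ 2 = 0 := by nlinarith [sq_nonneg ‖𝓛 v‖, sq_nonneg ‖𝓑 v‖]
    simpa using this
  have h3 : ‖𝓑 v‖ = 0 := by
    rw [h2] at h1
    simpa [hδ.ne'] using h1
  have h4 := h v
  rw [h2, h3] at h4
  simp at h4
  exact hv h4

theorem energyNorm_smul (hδ : 0 ≤ δ) {t : ℝ} (ht : 0 ≤ t) (v : X) :
    energyNorm 𝓛 𝓑 δ (t • v) = t * energyNorm 𝓛 𝓑 δ v := by
  rw [← norm_energyMap 𝓛 𝓑 hδ, ← norm_energyMap 𝓛 𝓑 hδ, map_smul, norm_smul,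
    Real.norm_of_nonneg ht]

theorem residual_eq_aLS_sub {f : V} {g : W} {u : X} (hδ : 0 ≤ δ)
    (hu : ∀ v, aLS 𝓛 𝓑 δ u v = FLS 𝓛 𝓑 δ f g v) (w v : X) :
    residual 𝓛 𝓑 δ f g w v = aLS 𝓛 𝓑 δ (u - w) v := by
  rw [residual, ← hu, ← inner_energyMap 𝓛 𝓑 hδ, ← inner_energyMap 𝓛 𝓑 hδ,
    ← inner_energyMap 𝓛 𝓑 hδ, map_sub, inner_sub_left]

theorem continuous_residual (f : V) (g : W) (w : X) : Continuous (residual 𝓛 𝓑 δ f g w) := by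
  unfold residual FLS aLS
  fun_prop

end Energy

/-! ### Geometry of unit vectors -/

section UnitVectors

variable {Z : Type*} [NormedAddCommGroup Z] [InnerProductSpace ℝ Z]

theorem norm_sub_le_of_inner_le {a b c : Z} (hb : ‖b‖ = 1) (hc : ‖c‖ = 1)
    (h : inner ℝ a c ≤ inner ℝ a b) : ‖a - b‖ ≤ ‖a - c‖ := by
  have h1 := norm_sub_sq_real a b
  have h2 := norm_sub_sq_real a c
  rw [hb] at h1
  rw [hc] at h2
  exact (sq_le_sq₀ (norm_nonneg _) (norm_nonneg _)).1 (by linarith)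

theorem norm_sub_normalize_le {a v : Z} (ha : ‖a‖ = 1) {ε : ℝ} (hv : ‖a - v‖ ≤ ε) (hε : ε < 1) :
    1 - ε ≤ ‖v‖ ∧ ‖a - ‖v‖⁻¹ • v‖ ≤ 2 * ε := by
  have h1 : 1 - ε ≤ ‖v‖ := by
    have := norm_sub_norm_le a v
    linarith
  have hpos : 0 < ‖v‖ := by linarith
  refine ⟨h1, ?_⟩
  -- Normalizing moves v by |‖v‖ - 1| = |‖v‖ - ‖a‖|.
  have h2 : ‖v - ‖v‖⁻¹ • v‖ ≤ ε := by
    have h3 : v - ‖v‖⁻¹ • v = (1 - ‖v‖⁻¹) • v := by rw [sub_smul, one_smul]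
    rw [h3, norm_smul, Real.norm_eq_abs, ← abs_of_pos hpos, ← abs_mul, abs_of_pos hpos, sub_mul,
      inv_mul_cancel₀ hpos.ne', one_mul, ← ha]
    refine le_trans ?_ hv
    rw [norm_sub_rev]
    exact abs_norm_sub_norm_le v a
  calc ‖a - ‖v‖⁻¹ • v‖ = ‖(a - v) + (v - ‖v‖⁻¹ • v)‖ := by rw [sub_add_sub_cancel]
    _ ≤ ‖a - v‖ + ‖v - ‖v‖⁻¹ • v‖ := norm_add_le _ _
    _ ≤ 2 * ε := by linarith

end UnitVectors

/-! ### Scaling of networks and of knowledge-based functions -/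

/-- Only the output coefficients are scaled, so the hidden layers contribute the factor 1 in the
maximum. -/
theorem exists_realize_smul (σ : ℝ → ℝ) (t : ℝ) (ns : List ℕ) (d : ℕ) (p : NetParams d ns) :
    ∃ p' : NetParams d ns, paramNorm d ns p' ≤ max 1 |t| * paramNorm d ns p ∧
      ∀ x, realize σ d ns p' x = t * realize σ d ns p x := by
  induction ns generalizing d with
  | nil =>
    let c : Fin d → ℝ := p
    refine ⟨(t • c : Fin d → ℝ), ?_, fun x => ?_⟩
    · change ‖t • c‖ ≤ max 1 |t| * ‖c‖
      rw [norm_smul, Real.norm_eq_abs]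
      gcongr
      exact le_max_right _ _
    · change ∑ l : Fin d, x l * (t • c) l = t * ∑ l : Fin d, x l * c l
      rw [Finset.mul_sum]
      refine Finset.sum_congr rfl fun l _ => ?_
      simp only [Pi.smul_apply, smul_eq_mul]
      ring
  | cons n ns ih =>
    obtain ⟨W, b, p⟩ := p
    obtain ⟨p', hp', hr⟩ := ih n p
    refine ⟨(W, b, p'), ?_, fun x => hr _⟩
    change ‖W‖ + ‖b‖ + paramNorm n ns p' ≤ max 1 |t| * (‖W‖ + ‖b‖ + paramNorm n ns p)
    have h1 : (1 : ℝ) ≤ max 1 |t| := le_max_left _ _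
    nlinarith [norm_nonneg W, norm_nonneg b]

theorem isCompact_finsetSum {ι X : Type*} [AddCommMonoid X] [TopologicalSpace X]
    [ContinuousAdd X] {A : ι → Set X} (s : Finset ι)
    (h : ∀ i ∈ s, IsCompact (A i)) : IsCompact (∑ i ∈ s, A i) := by
  classical
  induction s using Finset.induction_on with
  | empty => simp
  | insert a s ha ih =>
    rw [Finset.sum_insert ha]
    exact (h a (by simp)).add (ih fun i hi => h i (by simp [hi]))

section Sets

variable {d r : ℕ} {Ω : Set (Fin d → ℝ)} {X : Type*} [NormedAddCommGroup X]
  [InnerProductSpace ℝ X] (H : HilbertFunctionSpace d Ω r X)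

theorem exists_smul_mem_networkSet {σ : ℝ → ℝ} {ns : List ℕ} {p : NetParams d ns} {v : X}
    (hv : H.Represents v (realize σ d ns p)) (τ : ℝ) :
    ∃ C : ℝ, 0 < C ∧ ∀ t, 0 ≤ t → t ≤ τ → t • v ∈ networkSet H σ ns C := by
  refine ⟨max 1 |τ| * |paramNorm d ns p| + 1, by positivity, fun t ht0 ht => ?_⟩
  obtain ⟨p', hp', hr⟩ := exists_realize_smul σ t ns d p
  refine ⟨p', ?_, ?_⟩
  · have h1 : max 1 |t| ≤ max 1 |τ| :=
      max_le_max le_rfl (by rw [abs_of_nonneg ht0]; exact ht.trans (le_abs_self τ))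
    calc paramNorm d ns p' ≤ max 1 |t| * paramNorm d ns p := hp'
      _ ≤ max 1 |t| * |paramNorm d ns p| := by gcongr; exact le_abs_self _
      _ ≤ max 1 |τ| * |paramNorm d ns p| := by gcongr
      _ ≤ _ := by linarith
  · rw [funext hr]
    exact hv.smul t

theorem smul_coeff_represents {Φ : (Fin d → ℝ) → ℝ → ℝ} {m : ℕ} {c μ : Fin m → ℝ} {v : X}
    (hv : H.Represents v (fun x => ∑ j, c j * Φ x (μ j))) (t : ℝ) :
    H.Represents (t • v) (fun x => ∑ j, (t • c) j * Φ x (μ j)) := by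
  have := hv.smul t
  simpa [Finset.mul_sum, mul_assoc] using this

theorem norm_smul_le_of_mem_Icc {m : ℕ} (c : Fin m → ℝ) {t τ : ℝ} (ht0 : 0 ≤ t) (ht : t ≤ τ) :
    ‖t • c‖ ≤ τ * ‖c‖ := by
  rw [norm_smul, Real.norm_of_nonneg ht0]
  gcongr

theorem exists_smul_mem_knowledgeSetBdd {Φ : (Fin d → ℝ) → ℝ → ℝ} {m : ℕ} {v : X}
    (hv : v ∈ knowledgeSet H Φ m) (τ : ℝ) :
    ∃ C₀ : ℝ, ∀ C, C₀ ≤ C → ∀ t, 0 ≤ t → t ≤ τ → t • v ∈ knowledgeSetBdd H Φ m C := by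
  obtain ⟨c, μ, hμ, hv⟩ := hv
  refine ⟨τ * ‖c‖ + ‖μ‖, fun C hC t ht0 ht => ⟨t • c, μ, hμ, ?_, smul_coeff_represents H hv t⟩⟩
  linarith [norm_smul_le_of_mem_Icc c ht0 ht]

theorem exists_smul_mem_knowledgeSetFixedBdd {Φ : (Fin d → ℝ) → ℝ → ℝ} {m : ℕ} {μ : Fin m → ℝ}
    {v : X} (hv : v ∈ knowledgeSetFixed H Φ μ) (τ : ℝ) :
    ∃ C₀ : ℝ, ∀ C, C₀ ≤ C → ∀ t, 0 ≤ t → t ≤ τ → t • v ∈ knowledgeSetFixedBdd H Φ μ C := by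
  obtain ⟨c, hv⟩ := hv
  refine ⟨τ * ‖c‖ + ‖μ‖, fun C hC t ht0 ht => ⟨t • c, ?_, smul_coeff_represents H hv t⟩⟩
  linarith [norm_smul_le_of_mem_Icc c ht0 ht]

theorem exists_smul_mem_sum_knowledgeSetFixedBdd {Φ : (Fin d → ℝ) → ℝ → ℝ} {m : ℕ}
    {μ : ℕ → Fin m → ℝ} (s : Finset ℕ) {v : X} (hv : v ∈ ∑ l ∈ s, knowledgeSetFixed H Φ (μ l))
    (τ : ℝ) : ∃ C₀ : ℝ, ∀ C, C₀ ≤ C → ∀ t, 0 ≤ t → t ≤ τ →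
      t • v ∈ ∑ l ∈ s, knowledgeSetFixedBdd H Φ (μ l) C := by
  induction s using Finset.induction_on generalizing v with
  | empty =>
    refine ⟨0, fun C _ t _ _ => ?_⟩
    have : v = 0 := by simpa using hv
    simp [this]
  | insert a s ha ih =>
    rw [Finset.sum_insert ha] at hv
    obtain ⟨v₁, hv₁, v₂, hv₂, rfl⟩ := hv
    obtain ⟨C₁, h₁⟩ := exists_smul_mem_knowledgeSetFixedBdd H hv₁ τ
    obtain ⟨C₂, h₂⟩ := ih hv₂
    refine ⟨max C₁ C₂, fun C hC t ht0 ht => ?_⟩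
    rw [Finset.sum_insert ha, smul_add]
    exact Set.add_mem_add (h₁ C ((le_max_left _ _).trans hC) t ht0 ht)
      (h₂ C ((le_max_right _ _).trans hC) t ht0 ht)

theorem zero_mem_knowledgeSetBdd {Φ : (Fin d → ℝ) → ℝ → ℝ} {m : ℕ} {μ : Fin m → ℝ} {C : ℝ}
    (hμ : ∀ j, μ j ∈ admissible H Φ) (hC : ‖μ‖ ≤ C) : (0 : X) ∈ knowledgeSetBdd H Φ m C :=
  ⟨0, μ, hμ, by simpa using hC, by simpa using H.represents_zero⟩

theorem zero_mem_knowledgeSetFixedBdd {Φ : (Fin d → ℝ) → ℝ → ℝ} {m : ℕ} {μ : Fin m → ℝ} {C : ℝ}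
    (hC : ‖μ‖ ≤ C) : (0 : X) ∈ knowledgeSetFixedBdd H Φ μ C :=
  ⟨0, by simpa using hC, by simpa using H.represents_zero⟩

/-- `V_m^Φ(μ)` as a linear subspace. -/
def knowledgeFixedSubmodule (Φ : (Fin d → ℝ) → ℝ → ℝ) {m : ℕ} (μ : Fin m → ℝ) : Submodule ℝ X where
  carrier := knowledgeSetFixed H Φ μ
  add_mem' := by
    rintro u v ⟨c, hu⟩ ⟨c', hv⟩
    refine ⟨c + c', ?_⟩
    simpa [add_mul, Finset.sum_add_distrib] using hu.add hv
  zero_mem' := ⟨0, by simpa using H.represents_zero⟩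
  smul_mem' := by
    rintro t v ⟨c, hv⟩
    exact ⟨t • c, smul_coeff_represents H hv t⟩

theorem coe_sup_knowledgeFixedSubmodule (Φ : (Fin d → ℝ) → ℝ → ℝ) {m : ℕ} (μ : ℕ → Fin m → ℝ)
    (s : Finset ℕ) : ((s.sup fun l => knowledgeFixedSubmodule H Φ (μ l) : Submodule ℝ X) : Set X) =
      ∑ l ∈ s, knowledgeSetFixed H Φ (μ l) := by
  induction s using Finset.induction_on with
  | empty => simpa using Set.singleton_zero
  | insert a s ha ih =>
    rw [Finset.sup_insert, Submodule.coe_sup, ih, Finset.sum_insert ha]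
    rfl

theorem knowledgeSetFixedBdd_subset (Φ : (Fin d → ℝ) → ℝ → ℝ) {m : ℕ} (μ : Fin m → ℝ) (C : ℝ) :
    knowledgeSetFixedBdd H Φ μ C ⊆ knowledgeSetFixed H Φ μ := by
  rintro v ⟨c, _, hv⟩
  exact ⟨c, hv⟩

theorem isCompact_knowledgeSetFixedBdd {Φ : (Fin d → ℝ) → ℝ → ℝ} {m : ℕ} {μ : Fin m → ℝ}
    (hμ : ∀ j, μ j ∈ admissible H Φ) (C : ℝ) : IsCompact (knowledgeSetFixedBdd H Φ μ C) := by
  choose w hw using hμ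
  have hrep : ∀ c : Fin m → ℝ,
      H.Represents (∑ j, c j • w j) (fun x => ∑ j, c j * Φ x (μ j)) := fun c =>
    HilbertFunctionSpace.Represents.sum _ fun j _ =>
      HilbertFunctionSpace.Represents.smul (c j) (hw j)
  have hc : IsCompact {c : Fin m → ℝ | ‖c‖ + ‖μ‖ ≤ C} := by
    refine (isCompact_closedBall (0 : Fin m → ℝ) C).of_isClosed_subset
      (isClosed_le (by fun_prop) continuous_const) fun c hc => ?_
    have : ‖c‖ + ‖μ‖ ≤ C := hc
    simpa using by linarith [norm_nonneg μ]
  convert hc.image (f := fun c => ∑ j, c j • w j) (by fun_prop) using 1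
  ext v
  constructor
  · rintro ⟨c, hc, hv⟩
    exact ⟨c, hc, (hrep c).unique hv⟩
  · rintro ⟨c, hc, rfl⟩
    exact ⟨c, hc, hrep c⟩

end Sets

/-! ### Location of the singular part of the iterates -/

section Runs

variable {d r : ℕ} {Ω : Set (Fin d → ℝ)} {X V W : Type*} [NormedAddCommGroup X]
  [InnerProductSpace ℝ X] [NormedAddCommGroup V] [InnerProductSpace ℝ V] [NormedAddCommGroup W]
  [InnerProductSpace ℝ W] {𝓛 : X →L[ℝ] V} {𝓑 : X →L[ℝ] W} {δ : ℝ}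
  {H : HilbertFunctionSpace d Ω r X}

theorem Run.uΨ_mem_sup {f : V} {g : W} {σ : ℝ → ℝ} {Φ : (Fin d → ℝ) → ℝ → ℝ} {m k : ℕ}
    {μ : ℕ → Fin m → ℝ} (R : Run 𝓛 𝓑 δ H f g σ Φ m k μ) :
    R.uΨ k ∈ (Finset.range (k + 1)).sup fun l => knowledgeFixedSubmodule H Φ (μ l) := by
  have hle : ∀ l ≤ k, knowledgeFixedSubmodule H Φ (μ l) ≤
      (Finset.range (k + 1)).sup fun l => knowledgeFixedSubmodule H Φ (μ l) := fun l hl =>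
    Finset.le_sup (f := fun l => knowledgeFixedSubmodule H Φ (μ l))
      (Finset.mem_range.2 (Nat.lt_succ_of_le hl))
  have h0 := hle 0 k.zero_le R.initial
  rcases k with _ | k
  · exact h0
  · refine Submodule.span_le.2 ?_ (R.uΨ_mem k (Nat.lt_succ_self k))
    rintro w (hw | ⟨l, hl, rfl⟩)
    · rw [Set.mem_singleton_iff.1 hw]
      exact h0
    · obtain ⟨v₁, hv₁, v₂, hv₂, hv⟩ := R.φΨ_mem l (Nat.lt_succ_of_le hl)
      change v₁ + v₂ = _ at hv
      rw [← hv]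
      refine Submodule.add_mem _ (hle (l + 1) (by omega) (knowledgeSetFixedBdd_subset H _ _ _ hv₁)) ?_
      obtain ⟨g, hg, rfl⟩ := (Set.mem_finsetSum _ _ _).1 hv₂
      refine Submodule.sum_mem _ fun i hi => ?_
      have hi' := Finset.mem_range.1 hi
      exact hle i (by omega) (knowledgeSetFixedBdd_subset H _ _ _ (hg hi))

end Runs

/-! ### Choice of the widths and of the parameter bounds -/

section Choice

variable {d r : ℕ} {Ω : Set (Fin d → ℝ)} {X V W : Type*} [NormedAddCommGroup X]
  [InnerProductSpace ℝ X] [NormedAddCommGroup V] [InnerProductSpace ℝ V] [NormedAddCommGroup W]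
  [InnerProductSpace ℝ W] (H : HilbertFunctionSpace d Ω r X) (𝓛 : X →L[ℝ] V) (𝓑 : X →L[ℝ] W)
  {δ : ℝ}

/-- All multiples up to 1/(1-ε) are admitted because the actual normalizing factor depends on the
singular part, which must not influence this choice. -/
theorem exists_widths_bound (hΩb : Bornology.IsBounded Ω)
    (hstab : ∃ C : ℝ, 0 < C ∧ ∀ v : X, ‖v‖ ≤ C * (‖𝓛 v‖ + ‖𝓑 v‖)) (hδ : 0 < δ) {σ : ℝ → ℝ}
    (hσ : ContDiff ℝ r σ) (hσp : ¬ ∃ p : Polynomial ℝ, ∀ t, σ t = p.eval t) {L : ℕ} (hL : 1 ≤ L)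
    (ε : ℝ) (e : X) :
    ∃ (ns : List ℕ) (C : ℝ), ns.length = L ∧ (∀ q ∈ ns, 1 ≤ q) ∧ 0 < C ∧
      (0 < ε → ε < 1 → ∃ v : X, energyNorm 𝓛 𝓑 δ (e - v) ≤ ε / 2 ∧
        ∀ t, 0 ≤ t → t ≤ (1 - ε)⁻¹ → t • v ∈ networkSet H σ ns C) ∧
      (Nontrivial X → 1 ≤ ε → ∃ v ∈ networkSet H σ ns C, energyNorm 𝓛 𝓑 δ v = 1) := by
  by_cases hε : 0 < ε ∧ ε < 1
  · obtain ⟨hε0, hε1⟩ := hε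
    obtain ⟨ns, hlen, hpos, p, v, hv, hev⟩ := exists_network_near H hΩb hσ hσp hL e
      (η := ε / 2 / (‖energyMap 𝓛 𝓑 δ‖ + 1)) (by positivity)
    obtain ⟨C, hC, hmem⟩ := exists_smul_mem_networkSet H hv (1 - ε)⁻¹
    refine ⟨ns, C, hlen, hpos, hC, fun _ _ => ⟨v, ?_, hmem⟩, fun _ h => absurd hε1 (not_lt.2 h)⟩
    rw [← norm_energyMap 𝓛 𝓑 hδ.le]
    calc ‖energyMap 𝓛 𝓑 δ (e - v)‖ ≤ ‖energyMap 𝓛 𝓑 δ‖ * ‖e - v‖ :=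
          (energyMap 𝓛 𝓑 δ).le_opNorm _
      _ ≤ (‖energyMap 𝓛 𝓑 δ‖ + 1) * (ε / 2 / (‖energyMap 𝓛 𝓑 δ‖ + 1)) := by
          gcongr
          linarith
      _ = ε / 2 := by field_simp
  · by_cases hX : Nontrivial X
    · obtain ⟨e₀, he₀⟩ := exists_ne (0 : X)
      -- For ε ≥ 1 only feasibility is at stake: approximating e₀ better than 0 does yields a
      -- nonzero network, which is then normalized.
      obtain ⟨ns, hlen, hpos, p, v, hv, hev⟩ := exists_network_near H hΩb hσ hσp hL e₀
        (norm_pos_iff.2 he₀)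
      have hv0 : v ≠ 0 := by
        rintro rfl
        simp at hev
      have hpos' := energyNorm_pos 𝓛 𝓑 hstab hδ hv0
      obtain ⟨C, hC, hmem⟩ := exists_smul_mem_networkSet H hv (energyNorm 𝓛 𝓑 δ v)⁻¹
      refine ⟨ns, C, hlen, hpos, hC, fun h0 h1 => absurd ⟨h0, h1⟩ hε, fun _ _ =>
        ⟨_, hmem _ (by positivity) le_rfl, ?_⟩⟩
      rw [energyNorm_smul 𝓛 𝓑 hδ.le (by positivity), inv_mul_cancel₀ hpos'.ne']
    · obtain ⟨ns, hlen, hpos, _⟩ := exists_network_near H hΩb hσ hσp hL 0 one_pos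
      exact ⟨ns, 1, hlen, hpos, one_pos, fun h0 h1 => absurd ⟨h0, h1⟩ hε, fun h => absurd h hX⟩

/-- Approximability is a premise inside the statement, so that the bound can be chosen as a function
of ε and e before the data and the run are given. -/
theorem exists_knowledge_bound (Φ : (Fin d → ℝ) → ℝ → ℝ) {m : ℕ} (k : ℕ) (μ : ℕ → Fin m → ℝ)
    (δ ε : ℝ) (e : X) :
    ∃ C : ℝ, 0 < C ∧
      ((∀ j, μ k j ∈ admissible H Φ) → (0 : X) ∈ knowledgeSetBdd H Φ m C +
        ∑ l ∈ Finset.range (k + 1), knowledgeSetFixedBdd H Φ (μ l) C) ∧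
      ((∃ w ∈ knowledgeSet H Φ m + ∑ l ∈ Finset.range (k + 1), knowledgeSetFixed H Φ (μ l),
          energyNorm 𝓛 𝓑 δ (e - w) ≤ ε / 2) →
        ∃ w : X, energyNorm 𝓛 𝓑 δ (e - w) ≤ ε / 2 ∧ ∀ t, 0 ≤ t → t ≤ (1 - ε)⁻¹ →
          t • w ∈ knowledgeSetBdd H Φ m C +
            ∑ l ∈ Finset.range (k + 1), knowledgeSetFixedBdd H Φ (μ l) C) := by
  have hμ : ∀ l ∈ Finset.range (k + 1), ‖μ l‖ ≤ ∑ l ∈ Finset.range (k + 1), ‖μ l‖ := fun l hl =>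
    Finset.single_le_sum (f := fun l => ‖μ l‖) (fun _ _ => norm_nonneg _) hl
  have hzero : ∀ C, ∑ l ∈ Finset.range (k + 1), ‖μ l‖ ≤ C → (∀ j, μ k j ∈ admissible H Φ) →
      (0 : X) ∈ knowledgeSetBdd H Φ m C +
        ∑ l ∈ Finset.range (k + 1), knowledgeSetFixedBdd H Φ (μ l) C := by
    intro C hC hk
    -- Even the zero function needs admissible parameters within the bound; those of the last
    -- iteration serve.
    refine ⟨0, zero_mem_knowledgeSetBdd H hk ((hμ k (by simp)).trans hC), 0, ?_, by simp⟩
    exact (Set.mem_finsetSum _ _ _).2 ⟨fun _ => 0, fun hl =>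
      zero_mem_knowledgeSetFixedBdd H ((hμ _ hl).trans hC), by simp⟩
  have hsum : 0 ≤ ∑ l ∈ Finset.range (k + 1), ‖μ l‖ :=
    Finset.sum_nonneg fun _ _ => norm_nonneg _
  by_cases h : ∃ w ∈ knowledgeSet H Φ m + ∑ l ∈ Finset.range (k + 1), knowledgeSetFixed H Φ (μ l),
      energyNorm 𝓛 𝓑 δ (e - w) ≤ ε / 2
  · obtain ⟨_, ⟨w₁, hw₁, w₂, hw₂, rfl⟩, hw⟩ := h
    obtain ⟨C₁, h₁⟩ := exists_smul_mem_knowledgeSetBdd H hw₁ (1 - ε)⁻¹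
    obtain ⟨C₂, h₂⟩ := exists_smul_mem_sum_knowledgeSetFixedBdd H _ hw₂ (1 - ε)⁻¹
    refine ⟨∑ l ∈ Finset.range (k + 1), ‖μ l‖ + |C₁| + |C₂| + 1, by positivity,
      hzero _ (by linarith [abs_nonneg C₁, abs_nonneg C₂]), fun _ => ⟨w₁ + w₂, hw, ?_⟩⟩
    intro t ht0 ht
    rw [smul_add]
    exact Set.add_mem_add
      (h₁ _ (by linarith [le_abs_self C₁, abs_nonneg C₂]) t ht0 ht)
      (h₂ _ (by linarith [le_abs_self C₂, abs_nonneg C₁]) t ht0 ht)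
  · exact ⟨∑ l ∈ Finset.range (k + 1), ‖μ l‖ + 1, by positivity, hzero _ (by linarith),
      fun h' => absurd h' h⟩

variable {H 𝓛 𝓑}

theorem Run.exists_relative_error_approx {f : V} {g : W} {σ : ℝ → ℝ}
    {Φ : (Fin d → ℝ) → ℝ → ℝ} {m k : ℕ} {μ : ℕ → Fin m → ℝ} (R : Run 𝓛 𝓑 δ H f g σ Φ m k μ)
    (hδ : 0 ≤ δ) {N ε : ℝ} (hN : 0 < N) {uΨ : X}
    (h : ∃ w ∈ knowledgeSet H Φ m, energyNorm 𝓛 𝓑 δ (uΨ - w) ≤ ε / 2 * N) :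
    ∃ w ∈ knowledgeSet H Φ m + ∑ l ∈ Finset.range (k + 1), knowledgeSetFixed H Φ (μ l),
      energyNorm 𝓛 𝓑 δ (N⁻¹ • (uΨ - R.uΨ k) - w) ≤ ε / 2 := by
  obtain ⟨w, ⟨c, ν, hν, hw⟩, hle⟩ := h
  -- The iterate is reproduced exactly by the fixed-parameter spaces, so the whole error is that of
  -- w, divided by N.
  refine ⟨N⁻¹ • w + (-N⁻¹) • R.uΨ k, Set.add_mem_add
    ⟨N⁻¹ • c, ν, hν, smul_coeff_represents H hw _⟩ ?_, ?_⟩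
  · rw [← coe_sup_knowledgeFixedSubmodule]
    exact Submodule.smul_mem _ _ R.uΨ_mem_sup
  · have heq : N⁻¹ • (uΨ - R.uΨ k) - (N⁻¹ • w + (-N⁻¹) • R.uΨ k) = N⁻¹ • (uΨ - w) := by module
    rw [heq, energyNorm_smul 𝓛 𝓑 hδ (by positivity), inv_mul_le_iff₀ hN]
    linarith

end Choice

end XGNN

end

/-! ### Proof of the proposition, with k = i - 1 completed iterations -/

theorem mainTheorem4 {d r : ℕ} {Ω : Set (Fin d → ℝ)} (hΩ : IsOpen Ω)
    (hΩb : Bornology.IsBounded Ω)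
    {X V W : Type*} [NormedAddCommGroup X] [InnerProductSpace ℝ X] [CompleteSpace X]
    [NormedAddCommGroup V] [InnerProductSpace ℝ V] [CompleteSpace V]
    [NormedAddCommGroup W] [InnerProductSpace ℝ W] [CompleteSpace W]
    (H : XGNN.HilbertFunctionSpace d Ω r X) (𝓛 : X →L[ℝ] V) (𝓑 : X →L[ℝ] W)
    (hstab : ∃ C : ℝ, 0 < C ∧ ∀ v : X, ‖v‖ ≤ C * (‖𝓛 v‖ + ‖𝓑 v‖))
    (δ : ℝ) (hδ : 1 ≤ δ)
    (σ : ℝ → ℝ) (hσ : ContDiff ℝ r σ) (hσp : ¬ ∃ p : Polynomial ℝ, ∀ t, σ t = p.eval t)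
    (L : ℕ) (hL : 1 ≤ L) :
    -- the widths and the bound `C₁`, as functions of `ε` and of the smooth-part error
    ∃ (n : ℝ → X → List ℕ) (C₁ : ℝ → X → ℝ),
      (∀ ε e, (n ε e).length = L ∧ (∀ q ∈ n ε e, 1 ≤ q) ∧ 0 < C₁ ε e) ∧
      ∀ (Φ : (Fin d → ℝ) → ℝ → ℝ) (m k : ℕ) (μ : ℕ → Fin m → ℝ),
        -- the bound `C₂`, as a function of `ε` and of the singular-part error
        ∃ C₂ : ℝ → X → ℝ, (∀ ε e, 0 < C₂ ε e) ∧
          ∀ (f : V) (g : W) (Ψ : (Fin d → ℝ) → ℝ → ℝ) (M : ℕ) (lam : Fin M → ℝ) (u u_inf u_Ψ : X)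
            (R : XGNN.Run 𝓛 𝓑 δ H f g σ Φ m k μ) (ε N : ℝ) (e_σ e_Ψ : X),
            (∀ v, XGNN.aLS 𝓛 𝓑 δ u v = XGNN.FLS 𝓛 𝓑 δ f g v) →
            (∀ j, lam j ∈ XGNN.admissible H Ψ) →
            u_Ψ ∈ XGNN.knowledgeSetFixed H Ψ lam →
            u = u_inf + u_Ψ →
            u ≠ R.uσ k + R.uΨ k →
            0 < ε →
            N = XGNN.energyNorm 𝓛 𝓑 δ (u - (R.uσ k + R.uΨ k)) →
            e_σ = N⁻¹ • (u_inf - R.uσ k) →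
            e_Ψ = N⁻¹ • (u_Ψ - R.uΨ k) →
            (∃ w ∈ XGNN.knowledgeSet H Φ m, XGNN.energyNorm 𝓛 𝓑 δ (u_Ψ - w) ≤ ε / 2 * N) →
            -- the feasible set of the maximization problem is nonempty
            (∃ v ∈ XGNN.searchSet H σ (n ε e_σ) (C₁ ε e_σ) Φ m (C₂ ε e_Ψ) μ (k + 1),
              XGNN.energyNorm 𝓛 𝓑 δ v = 1) ∧
            -- a maximizer exists as soon as the nonlinear knowledge-based set is compact
            (IsCompact (XGNN.knowledgeSetBdd H Φ m (C₂ ε e_Ψ)) →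
              ∃ φ, XGNN.IsResidualArgmax 𝓛 𝓑 δ f g (R.uσ k + R.uΨ k)
                (XGNN.searchSet H σ (n ε e_σ) (C₁ ε e_σ) Φ m (C₂ ε e_Ψ) μ (k + 1)) φ) ∧
            -- every maximizer approximates the normalized error
            (∀ φ, XGNN.IsResidualArgmax 𝓛 𝓑 δ f g (R.uσ k + R.uΨ k)
                (XGNN.searchSet H σ (n ε e_σ) (C₁ ε e_σ) Φ m (C₂ ε e_Ψ) μ (k + 1)) φ →
              XGNN.energyNorm 𝓛 𝓑 δ (N⁻¹ • (u - (R.uσ k + R.uΨ k)) - φ) ≤ 2 * ε) := by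
  have hδ0 : 0 < δ := by linarith
  choose n C₁ hlen hpos hC₁ hsmall hlarge using
    XGNN.exists_widths_bound H 𝓛 𝓑 hΩb hstab hδ0 hσ hσp hL
  refine ⟨n, C₁, fun ε e => ⟨hlen ε e, hpos ε e, hC₁ ε e⟩, fun Φ m k μ => ?_⟩
  choose C₂ hC₂ hzero happrox using XGNN.exists_knowledge_bound H 𝓛 𝓑 Φ k μ δ
  refine ⟨C₂, hC₂, ?_⟩
  intro f g Ψ M lam u u_inf u_Ψ R ε N e_σ e_Ψ hu _ _ hsplit hne hε hN hσe hΨe hw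
  set w := R.uσ k + R.uΨ k with hw_def
  set S := XGNN.searchSet H σ (n ε e_σ) (C₁ ε e_σ) Φ m (C₂ ε e_Ψ) μ (k + 1) with hS
  have hNpos : 0 < N := hN ▸ XGNN.energyNorm_pos 𝓛 𝓑 hstab hδ0 (sub_ne_zero.2 hne)
  have hφ1 : ‖XGNN.energyMap 𝓛 𝓑 δ (N⁻¹ • (u - w))‖ = 1 := by
    rw [XGNN.norm_energyMap 𝓛 𝓑 hδ0.le, XGNN.energyNorm_smul 𝓛 𝓑 hδ0.le (by positivity), ← hN,
      inv_mul_cancel₀ hNpos.ne']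
  have hfeas : ∃ v ∈ S, XGNN.energyNorm 𝓛 𝓑 δ v = 1 ∧
      (ε < 1 → XGNN.energyNorm 𝓛 𝓑 δ (N⁻¹ • (u - w) - v) ≤ 2 * ε) := by
    rcases lt_or_ge ε 1 with hε1 | hε1
    · obtain ⟨v₁, hv₁, hmem₁⟩ := hsmall ε e_σ hε hε1
      obtain ⟨v₂, hv₂, hmem₂⟩ := happrox ε e_Ψ
        (hΨe ▸ R.exists_relative_error_approx hδ0.le hNpos hw)
      rw [← XGNN.norm_energyMap 𝓛 𝓑 hδ0.le] at hv₁ hv₂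
      have hclose : ‖XGNN.energyMap 𝓛 𝓑 δ (N⁻¹ • (u - w)) -
          XGNN.energyMap 𝓛 𝓑 δ (v₁ + v₂)‖ ≤ ε := by
        have heq : N⁻¹ • (u - w) - (v₁ + v₂) = (e_σ - v₁) + (e_Ψ - v₂) := by
          rw [hσe, hΨe, hsplit, hw_def]
          module
        rw [← map_sub, heq, map_add]
        exact (norm_add_le _ _).trans (by linarith)
      obtain ⟨hge, hle⟩ := XGNN.norm_sub_normalize_le hφ1 hclose hε1
      have hε1' : 0 < 1 - ε := by linarith
      -- One factor scales both parts; since t ≤ 1/(1-ε), each stays within its separately chosen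
      -- bound.
      set t := ‖XGNN.energyMap 𝓛 𝓑 δ (v₁ + v₂)‖⁻¹ with ht
      have ht0 : 0 ≤ t := by positivity
      have ht1 : t ≤ (1 - ε)⁻¹ := inv_anti₀ hε1' hge
      refine ⟨t • v₁ + t • v₂, Set.add_mem_add (hmem₁ t ht0 ht1) (hmem₂ t ht0 ht1), ?_, fun _ => ?_⟩
      · rw [← smul_add, XGNN.energyNorm_smul 𝓛 𝓑 hδ0.le ht0, ← XGNN.norm_energyMap 𝓛 𝓑 hδ0.le, ht,
          inv_mul_cancel₀ (by linarith)]
      · rw [← smul_add, ← XGNN.norm_energyMap 𝓛 𝓑 hδ0.le, map_sub, map_smul _ t]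
        exact hle
    · obtain ⟨v, hv, hv1⟩ := hlarge ε e_σ ⟨u, w, hne⟩ hε1
      refine ⟨v, ?_, hv1, fun h => absurd h (not_lt.2 hε1)⟩
      have := Set.add_mem_add hv (hzero ε e_Ψ (R.μ_mem k le_rfl))
      rwa [add_zero] at this
  obtain ⟨v, hvS, hv1, hvε⟩ := hfeas
  refine ⟨⟨v, hvS, hv1⟩, fun hcomp => ?_, fun φ hφ => ?_⟩
  · have hSc : IsCompact S := (XGNN.isCompact_networkSet H hΩb hσ _ _).add
      (hcomp.add (XGNN.isCompact_finsetSum _ fun l hl => XGNN.isCompact_knowledgeSetFixedBdd H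
        (R.μ_mem l (Nat.lt_succ_iff.1 (Finset.mem_range.1 hl))) _))
    have hclosed : IsClosed {v : X | XGNN.energyNorm 𝓛 𝓑 δ v = 1} := by
      simp only [← XGNN.norm_energyMap 𝓛 𝓑 hδ0.le]
      exact isClosed_eq (by fun_prop) continuous_const
    obtain ⟨φ, ⟨hφS, hφ⟩, hmax⟩ := (hSc.inter_right hclosed).exists_isMaxOn ⟨v, hvS, hv1⟩
      (XGNN.continuous_residual 𝓛 𝓑 f g w).continuousOn
    exact ⟨φ, hφS, hφ, fun v hv hv1 => hmax ⟨hv, hv1⟩⟩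
  · obtain ⟨_, hφn, hmax⟩ := hφ
    rw [← XGNN.norm_energyMap 𝓛 𝓑 hδ0.le] at hφn ⊢
    rw [map_sub]
    rcases lt_or_ge ε 1 with hε1 | hε1
    · have h1 := hmax v hvS hv1
      have h2 := hvε hε1
      rw [XGNN.residual_eq_aLS_sub 𝓛 𝓑 hδ0.le hu, XGNN.residual_eq_aLS_sub 𝓛 𝓑 hδ0.le hu,
        ← XGNN.inner_energyMap 𝓛 𝓑 hδ0.le, ← XGNN.inner_energyMap 𝓛 𝓑 hδ0.le] at h1
      rw [← XGNN.norm_energyMap 𝓛 𝓑 hδ0.le] at h2 hv1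
      rw [map_sub] at h2
      -- The maximizer beats the feasible v in residual, that is, up to the factor N, in inner
      -- product with φ_i.
      refine (XGNN.norm_sub_le_of_inner_le hφn hv1 ?_).trans h2
      rw [map_smul, inner_smul_left, inner_smul_left]
      exact mul_le_mul_of_nonneg_left h1 (by simpa using hNpos.le)
    -- Two unit vectors are at distance at most 2 ≤ 2ε.
    · refine (norm_sub_le _ _).trans ?_
      rw [hφ1, hφn]
      linarith
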